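/- **Theorem (Partial spectral theorem).** Let $\mathbb K\in\{\mathbb R,\mathbb C\}$, let $H$ be an infinite-dimensional separable Hilbert space over $\mathbb K$, with inner product $(\cdot,\cdot)$ linear in the first variable, and let $A:\operatorname{dom}(A)\to H$ be a densely defined symmetric linear operator (not assumed bounded or self-adjoint). Fix an $\aleph_1$-saturated nonstandard extension ${}^*$; here $\mathbb N=\{1,2,\dots\}$, $\operatorname{st}$ is the standard part, $G(\cdot)$ denotes the graph, and $T_1\le T_2$ means $G(T_1)\subseteq G(T_2)$. Let $(\tilde H,\tilde A,\tilde\Omega)$ be a *sampling for $A$*, i.e. an internal triple such that $\tilde H$ is an internal subspace of ${}^*H$ of hyperfinite dimension, $\tilde A:\tilde H\to\tilde H$ is ${}^*$linear and symmetric, $\tilde\Omega$ is an orthonormal ${}^*$basis of $\tilde H$ formed by eigenvectors of $\tilde A$, and $G(A)\subseteq\operatorname{st}(G(\tilde A))$, where $\operatorname{st}(G(\tilde A))$ is the set of all $(x,y)\in H\times H$ for which there is $\tilde x\in\tilde H$ with $x=\operatorname{st}(\tilde x)$ and $y=\operatorname{st}(\tilde A\tilde x)$. Let $\tilde\lambda_f\in{}^*\mathbb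 R$ be the eigenvalue of $\tilde A$ at $f\in\tilde\Omega$. Let $N\in{}^*\mathbb N\setminus\mathbb N$, and let $(\tilde e_j)_{1\le j\le N}$ in ${}^*H$ and $(\tilde c_j)_{1\le j\le N}$ in ${}^*\mathbb R_{\ge0}$ be internal sequences forming a *standard-biased scale compatible with the sampling*, i.e. 1. for each $j\in\mathbb N$, $\tilde e_j$ and $\tilde c_j$ are nearstandard and $\operatorname{st}(\tilde c_j\tilde e_j)\ne0$; 2. $(\operatorname{st}(\tilde e_j))_{j\in\mathbb N}$ spans a dense subspace of $H$; 3. $\sum_{j=1}^N\tilde c_j\|\tilde e_j\|^2=1$; 4. $\operatorname{st}\big(\sum_{K<j\le N}\tilde c_j\|\tilde e_j\|^2\big)=0$ for every infinite $K\in{}^*\mathbb N$; 5. $\tilde e_j\in\tilde H$ for every $1\le j\le N$; 6. $\tilde A\tilde e_j$ is nearstandard for every $j\in\mathbb N$; 7. for every $f\in\tilde\Omega$ there is $1\le j\le N$ with $\tilde c_j>0$ and $(\tilde e_j,f)\ne0$. For internal $V\subseteq\tilde\Omega$ put $\tilde\mu(V)=\sum_{j=1}^N\tilde c_j\sum_{f\in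 V}|(\tilde e_j,f)|^2$, and let $(\Omega_L,\mathcal A_L,\mu_L)$, with $\Omega_L=\tilde\Omega$, be the Loeb space of $\tilde\mu$: $\mu_L$ is the Carathéodory measure of the outer measure $B\mapsto\inf\sum_n\operatorname{st}(\tilde\mu(V_n))$, the infimum being over countable covers of $B$ by internal sets $V_n$. Let $H_L=L_2(\Omega_L,\mathcal A_L,\mu_L;\mathbb K)$. For $x\in H$ and $f\in\tilde\Omega$ let $(\tilde U(x))(f)=(x,f)/\sqrt{\tilde\mu(\{f\})}$ and $U_L(x)=\operatorname{st}\circ\tilde U(x)$. Let $m_L=\operatorname{st}\circ\tilde\lambda:\Omega_L\to\mathbb R\cup\{\pm\infty\}$, and let $T_L$ be the operator of multiplication by $m_L$ on $H_L$, with domain $\{g\in H_L: m_Lg\in H_L\}$. Then: * $\mu_L$ is a complete probability measure, every internal $V\subseteq\tilde\Omega$ belongs to $\mathcal A_L$, and $\mu_L(V)=\operatorname{st}(\tilde\mu(V))$; * for every $x\in H$, $(\tilde U(x))(f)$ is nearstandard for $\mu_L$-almost every $f$, and $U_L$ is a well-defined linear isometry $H\to H_L$; * $m_L$ is measurable and $\mu_L$-almost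 everywhere real-valued, and $T_L$ is a densely defined self-adjoint operator on $H_L$; * for every $(x,y)\in\operatorname{st}(G(\tilde A))$, $U_L(x)\in\operatorname{dom}(T_L)$ and $U_L(y)=T_L(U_L(x))$; * in particular, $U_L\circ A\le T_L\circ U_L$. -/

import Mathlib

open MeasureTheory Filter
open scoped ENNReal InnerProductSpace

universe u v

set_option linter.checkUnivs false

/-- A nonstandard extension `*` of the standard mathematical objects, presented through its effect
on sets and functions: every standard set `X` has an extension `star X`, every standard function
`g : X → Y` has an extension `map g : star X → star Y`, and `*` respects composition, singletons,
products, sets defined by equations, the empty set and complements. Since every set-theoretic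
surjection has a section, images (existential quantifiers) are then respected too, so that these
clauses are the transfer principle for all first-order statements about standard sets; as `X` may
be a power set, a set of functions and so on, bounded statements of higher order are covered.
Ultrapowers and limit ultrapowers are the basic examples. -/
structure NonstandardExtension where
  /-- the extension `*X` of a standard set `X` -/
  star : Type u → Type v
  /-- the extension `*g` of a standard function `g` -/
  map : ∀ {X Y : Type u}, (X → Y) → star X → star Y
  map_id : ∀ (X : Type u) (a : star X), map (fun x : X => x) a = a
  map_comp : ∀ {X Y Z : Type u} (h : Y → Z) (g : X → Y) (a : star X),
    map (fun x => h (g x)) a = map h (map g a)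
  /-- the extension of a singleton is a singleton -/
  star_unit : Nonempty (Unique (star PUnit.{u + 1}))
  /-- the extension of the empty set is empty -/
  star_empty : IsEmpty (star PEmpty.{u + 1})
  /-- `*(X × Y) = *X × *Y` -/
  star_prod : ∀ X Y : Type u, Function.Bijective
    (fun p : star (X × Y) => ((map Prod.fst p, map Prod.snd p) : star X × star Y))
  /-- `{a | *g a = *h a} = *{x | g x = h x}` -/
  star_eq : ∀ {X Y : Type u} (g h : X → Y) (a : star X), map g a = map h a →
    ∃ b : star {x : X // g x = h x}, map Subtype.val b = a
  /-- `*X = *S ∪ *(X \ S)` for `S ⊆ X` -/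
  star_compl : ∀ {X : Type u} (S : X → Prop) (a : star X),
    (∃ b : star {x : X // S x}, map Subtype.val b = a) ∨
      ∃ b : star {x : X // ¬ S x}, map Subtype.val b = a

namespace NonstandardExtension

variable (E : NonstandardExtension.{u, v})

section Basic

variable {X Y Z W : Type u}

/-- The internal pair with given components. -/
noncomputable def pair (a : E.star X) (b : E.star Y) : E.star (X × Y) :=
  ((E.star_prod X Y).2 (a, b)).choose

theorem map_fst_pair (a : E.star X) (b : E.star Y) : E.map Prod.fst (E.pair a b) = a :=
  congrArg Prod.fst ((E.star_prod X Y).2 (a, b)).choose_spec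

theorem map_snd_pair (a : E.star X) (b : E.star Y) : E.map Prod.snd (E.pair a b) = b :=
  congrArg Prod.snd ((E.star_prod X Y).2 (a, b)).choose_spec

/-- The value at `(a, b)` of the extension of a standard function of two variables. -/
noncomputable def map₂ (g : X → Y → Z) (a : E.star X) (b : E.star Y) : E.star Z :=
  E.map (fun p : X × Y => g p.1 p.2) (E.pair a b)

/-- The value at `(a, b, c)` of the extension of a standard function of three variables. -/
noncomputable def map₃ (g : X → Y → Z → W) (a : E.star X) (b : E.star Y) (c : E.star Z) :
    E.star W :=
  E.map (fun p : X × Y × Z => g p.1 p.2.1 p.2.2) (E.pair a (E.pair b c))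

/-- `a ∈ *{x | P x}`: the extension of the standard predicate `P` holds at `a`. -/
def Holds (P : X → Prop) (a : E.star X) : Prop :=
  ∃ b : E.star {x : X // P x}, E.map Subtype.val b = a

/-- The extension of a standard binary relation. -/
def Holds₂ (R : X → Y → Prop) (a : E.star X) (b : E.star Y) : Prop :=
  E.Holds (fun p : X × Y => R p.1 p.2) (E.pair a b)

/-- The extension of a standard ternary relation. -/
def Holds₃ (R : X → Y → Z → Prop) (a : E.star X) (b : E.star Y) (c : E.star Z) : Prop :=
  E.Holds (fun p : X × Y × Z => R p.1 p.2.1 p.2.2) (E.pair a (E.pair b c))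

/-- `a` is an element of the internal set `V`. An element `V` of `*𝒫(X)` represents the internal
subset `{a | a ∈ V}` of `*X`. -/
def Mem (a : E.star X) (V : E.star (Set X)) : Prop :=
  E.Holds₂ (fun x S => x ∈ S) a V

end Basic

/-- `ℵ₁`-saturation for internal subsets of `*X`: every countable family of internal subsets of `*X`
with the finite intersection property has a common point. -/
def CountablySaturatedAt (X : Type u) : Prop :=
  ∀ B : ℕ → E.star (Set X), (∀ n, ∃ a : E.star X, ∀ k ≤ n, E.Mem a (B k)) →
    ∃ a : E.star X, ∀ k, E.Mem a (B k)

section StandardPart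

/-- `*Y` for `Y = ℕ, ℝ, 𝕜` (moved to the universe level of the extension). -/
abbrev Hyper (Y : Type) : Type v := E.star (ULift.{u} Y)

/-- The standard point `x` of a metric space `X` is the standard part of `a ∈ *X`. -/
def IsSt {X : Type u} [PseudoMetricSpace X] (a : E.star X) (x : X) : Prop :=
  ∀ ε : ℝ, 0 < ε → E.Holds (fun z => dist z x < ε) a

/-- `a ∈ *X` is nearstandard. -/
def Nearstandard {X : Type u} [PseudoMetricSpace X] (a : E.star X) : Prop := ∃ x : X, E.IsSt a x

open Classical in
/-- The standard part in `𝕜` of a nearstandard (equivalently, limited) element of `*𝕜`, and `0` for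
the other elements. -/
noncomputable def st {𝕜 : Type} [RCLike 𝕜] (a : E.Hyper 𝕜) : 𝕜 :=
  if h : ∃ z : 𝕜, E.IsSt a (ULift.up z) then h.choose else 0

/-- The standard part in `[-∞, ∞]` of a hyperreal, as the supremum of the standard reals
below it: the usual standard part if `a` is limited, and `±∞` if `a` is infinite. -/
noncomputable def stE (a : E.Hyper ℝ) : EReal :=
  sSup {q : EReal | ∃ t : ℝ, q = (t : EReal) ∧ E.Holds (fun z : ULift.{u} ℝ => t < z.down) a}

/-- A hypernatural number is infinite, that is, belongs to `*ℕ \ ℕ`. -/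
def IsInfinite (K : E.Hyper ℕ) : Prop :=
  ∀ n : ℕ, E.Holds (fun k : ULift.{u} ℕ => n < k.down) K

end StandardPart

end NonstandardExtension

section FiniteModels

/-- The standard triples `(V, T, Ω)` whose `*`-versions are the internal triples of a sampling: a
finite-dimensional subspace `V` of `H`, a symmetric linear operator `T : V → V` and an orthonormal
basis `Ω` of `V` formed by eigenvectors of `T`. -/
structure FinModel (𝕜 : Type) (H : Type*) [RCLike 𝕜] [NormedAddCommGroup H]
    [InnerProductSpace 𝕜 H] where
  V : Submodule 𝕜 H
  finite_dim : FiniteDimensional 𝕜 V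
  T : V →ₗ[𝕜] V
  symm : T.IsSymmetric
  Ω : Finset H
  orthonormal : Orthonormal 𝕜 (fun f : Ω => (f : H))
  span_eq : Submodule.span 𝕜 (Ω : Set H) = V
  eigen : ∀ (f : H) (hf : f ∈ V), f ∈ Ω → ∃ a : 𝕜, Module.End.HasEigenvector T a ⟨f, hf⟩

/-- The standard finite sequences `(e_j)`, `(c_j)`, `j = 1, …, N`, with `c_j ≥ 0`. Only the values
of `e` and `c` at the indices `1, …, N` play a role. -/
structure FinScale (H : Type*) where
  N : ℕ
  e : ℕ → H
  c : ℕ → ℝ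
  c_nonneg : ∀ j ∈ Finset.Icc 1 N, 0 ≤ c j

variable {𝕜 : Type} {H : Type*} [RCLike 𝕜] [NormedAddCommGroup H] [InnerProductSpace 𝕜 H]

namespace FinModel

/-- `(x, y)` belongs to the graph of `T : V → V`. -/
def InGraph (d : FinModel 𝕜 H) (x y : H) : Prop :=
  ∃ hx : x ∈ d.V, (d.T ⟨x, hx⟩ : H) = y

open Classical in
/-- The eigenvalue of `T` at a basis vector `f ∈ Ω`, as `⟪f, T f⟫` with `f` of norm one. -/
noncomputable def eigenvalue (d : FinModel 𝕜 H) (f : H) : ℝ :=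
  if hf : f ∈ d.V then RCLike.re ⟪f, (d.T ⟨f, hf⟩ : H)⟫_𝕜 else 0

theorem inGraph_eigenvalue (d : FinModel 𝕜 H) {f : H} (hf : f ∈ d.Ω) :
    d.InGraph f (((d.eigenvalue f : ℝ) : 𝕜) • f) := by
  have hV : f ∈ d.V := d.span_eq ▸ Submodule.subset_span (Finset.mem_coe.2 hf)
  obtain ⟨a, ha⟩ := d.eigen f hV hf
  have h1 : ‖f‖ = 1 := d.orthonormal.1 ⟨f, hf⟩
  have h2 : (d.T ⟨f, hV⟩ : H) = a • f := congrArg Subtype.val ha.apply_eq_smul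
  have h3 : (starRingEnd 𝕜) a = a :=
    d.symm.conj_eigenvalue_eq_self (Module.End.hasEigenvalue_of_hasEigenvector ha)
  refine ⟨hV, ?_⟩
  rw [h2, eigenvalue, dif_pos hV, h2, inner_smul_right, inner_self_eq_norm_sq_to_K, h1]
  simp [RCLike.conj_eq_iff_re.1 h3]

open Classical in
/-- The measure `∑_j c_j ∑_{f ∈ Ω ∩ S} |(e_j, f)|²` of a set `S`. -/
noncomputable def meas (d : FinModel 𝕜 H) (w : FinScale H) (S : Set H) : ℝ :=
  ∑ j ∈ Finset.Icc 1 w.N, w.c j * ∑ f ∈ d.Ω with f ∈ S, ‖⟪f, w.e j⟫_𝕜‖ ^ 2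

/-- The function `(U x)(f) = (x, f) / √μ({f})`, where the scalar product `(x, f)` is linear in `x`
and antilinear in `f`. -/
noncomputable def transform (d : FinModel 𝕜 H) (w : FinScale H) (x f : H) : 𝕜 :=
  ⟪f, x⟫_𝕜 / ((Real.sqrt (d.meas w {f}) : ℝ) : 𝕜)

end FinModel

end FiniteModels

namespace NonstandardExtension

variable (E : NonstandardExtension.{u, v}) {𝕜 : Type} {H : Type u} [RCLike 𝕜]
  [NormedAddCommGroup H] [InnerProductSpace 𝕜 H]

/-- `st(G(Ã))`: the pairs `(x, y) ∈ H × H` that are the standard part of a point of the graph of the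
internal operator `Ã` of the internal triple `D = (H̃, Ã, Ω̃)`. -/
def stGraph (D : E.star (FinModel 𝕜 H)) : Set (H × H) :=
  {p | ∃ x y : E.star H, E.Holds₃ (fun d x y => d.InGraph x y) D x y ∧ E.IsSt x p.1 ∧ E.IsSt y p.2}

/-- The internal triple `D = (H̃, Ã, Ω̃)` is a sampling for `A`. That `H̃` is a subspace of `*H` of
hyperfinite dimension, `Ã : H̃ → H̃` is `*`-linear and symmetric, and `Ω̃` is an orthonormal `*`-basis
of `H̃` formed by eigenvectors of `Ã` is expressed by `D` being an element of the extension of the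
set of standard triples with these properties. -/
def IsSampling (A : H →ₗ.[𝕜] H) (D : E.star (FinModel 𝕜 H)) : Prop :=
  ∀ x : A.domain, ((x : H), A x) ∈ E.stGraph D

/-- The pair of hyperfinite sequences `S = ((ẽ_j), (c̃_j))`, `j = 1, …, N`, is a standard-biased
scale. -/
structure IsStandardBiased (𝕜 : Type) {H : Type u} [RCLike 𝕜] [NormedAddCommGroup H]
    [InnerProductSpace 𝕜 H] (S : E.star (FinScale H)) : Prop where
  N_infinite : E.IsInfinite (E.map (fun w => ULift.up w.N) S)
  e_nearstandard : ∀ j : ℕ, 1 ≤ j → E.Nearstandard (E.map (fun w => w.e j) S)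
  c_nearstandard : ∀ j : ℕ, 1 ≤ j → E.Nearstandard (E.map (fun w => ULift.up (w.c j)) S)
  st_ne_zero : ∀ j : ℕ, 1 ≤ j →
    ∃ z : H, z ≠ 0 ∧ E.IsSt (E.map (fun w => ((w.c j : ℝ) : 𝕜) • w.e j) S) z
  dense_span : Dense (Submodule.span 𝕜
    {x : H | ∃ j : ℕ, 1 ≤ j ∧ E.IsSt (E.map (fun w => w.e j) S) x} : Set H)
  sum_eq_one : E.Holds (fun w => ∑ j ∈ Finset.Icc 1 w.N, w.c j * ‖w.e j‖ ^ 2 = 1) S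
  tail : ∀ K : E.Hyper ℕ, E.IsInfinite K →
    E.IsSt (E.map₂ (fun k w => ULift.up.{u}
      (∑ j ∈ Finset.Icc 1 w.N with k.down < j, w.c j * ‖w.e j‖ ^ 2)) K S) (ULift.up (0 : ℝ))

/-- The scale `S` is compatible with the sampling `D = (H̃, Ã, Ω̃)`. -/
structure IsCompatible (D : E.star (FinModel 𝕜 H)) (S : E.star (FinScale H)) : Prop where
  e_mem : E.Holds₂ (fun d w => ∀ j ∈ Finset.Icc 1 w.N, w.e j ∈ d.V) D S
  image_nearstandard : ∀ j : ℕ, 1 ≤ j → ∃ y : E.star H,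
    E.Holds₃ (fun d x y => d.InGraph x y) D (E.map (fun w => w.e j) S) y ∧ E.Nearstandard y
  detects : E.Holds₂ (fun d w => ∀ f ∈ d.Ω, ∃ j ∈ Finset.Icc 1 w.N,
    0 < w.c j ∧ ⟪f, w.e j⟫_𝕜 ≠ 0) D S

/-- The set `Ω_L = Ω̃` of the Loeb space of the sampling `D = (H̃, Ã, Ω̃)` and the scale `S`. -/
def LoebSpace (D : E.star (FinModel 𝕜 H)) (_S : E.star (FinScale H)) : Type v :=
  {f : E.star H // E.Holds₂ (fun d f => f ∈ d.Ω) D f}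

section Loeb

variable (D : E.star (FinModel 𝕜 H)) (S : E.star (FinScale H))

/-- The internal subset `V ∩ Ω̃` of `Ω̃`, for an internal `V ⊆ *H`. -/
def internalSet (V : E.star (Set H)) : Set (E.LoebSpace D S) :=
  {f | E.Mem f.1 V}

/-- The internal measure `μ̃(V ∩ Ω̃) ∈ *ℝ` of the internal set `V ∩ Ω̃`. -/
noncomputable def internalMeasure (V : E.star (Set H)) : E.Hyper ℝ :=
  E.map₃ (fun d w V => ULift.up (d.meas w V)) D S V

/-- The Loeb outer measure: the infimum of `∑ st(μ̃(V_n))` over countable covers by internal sets. -/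
noncomputable def loebOuter : OuterMeasure (E.LoebSpace D S) :=
  OuterMeasure.boundedBy fun B =>
    ⨅ (V : E.star (Set H)) (_ : B ⊆ E.internalSet D S V), (E.stE (E.internalMeasure D S V)).toENNReal

/-- The Loeb `σ`-algebra: the Carathéodory measurable sets of the Loeb outer measure. -/
noncomputable instance : MeasurableSpace (E.LoebSpace D S) := (E.loebOuter D S).caratheodory

/-- The Loeb measure `μ_L`. -/
noncomputable def loebMeasure : Measure (E.LoebSpace D S) :=
  (E.loebOuter D S).toMeasure le_rfl

/-- The value `(Ũ x)(f) = (x, f) / √μ̃({f}) ∈ *𝕜` for a standard `x ∈ H` and `f ∈ Ω̃`. -/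
noncomputable def internalU (x : H) (f : E.LoebSpace D S) : E.Hyper 𝕜 :=
  E.map₃ (fun d w f => ULift.up (d.transform w x f)) D S f.1

/-- `m_L = st ∘ λ̃ : Ω_L → [-∞, ∞]`, where `λ̃_f ∈ *ℝ` is the eigenvalue of `Ã` at `f ∈ Ω̃`. -/
noncomputable def loebMultiplier (f : E.LoebSpace D S) : EReal :=
  E.stE (E.map₂ (fun d f => ULift.up (d.eigenvalue f)) D f.1)

end Loeb

end NonstandardExtension

/-- The operator of multiplication by a real function `m` on `L₂(μ)`, with its maximal domain
`{g ∈ L₂(μ) | m g ∈ L₂(μ)}`. -/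
noncomputable def mulOperator (𝕜 : Type) [RCLike 𝕜] {X : Type*} [MeasurableSpace X] (μ : Measure X)
    (m : X → ℝ) : Lp 𝕜 2 μ →ₗ.[𝕜] Lp 𝕜 2 μ where
  domain :=
    { carrier := {g | MemLp (fun t => ((m t : ℝ) : 𝕜) * g t) 2 μ}
      add_mem' := by
        intro g h hg hh
        refine (MemLp.add hg hh).ae_eq ?_
        filter_upwards [Lp.coeFn_add g h] with t ht
        simp only [Pi.add_apply, ht, mul_add]
      zero_mem' := by
        refine (MemLp.zero (ε := 𝕜) (p := 2) (μ := μ)).ae_eq ?_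
        filter_upwards [Lp.coeFn_zero 𝕜 2 μ] with t ht
        rw [ht]
        simp
      smul_mem' := by
        intro a g hg
        refine (MemLp.const_smul hg a).ae_eq ?_
        filter_upwards [Lp.coeFn_smul a g] with t ht
        simp only [Pi.smul_apply, ht, smul_eq_mul]
        ring }
  toFun :=
    { toFun := fun g => MemLp.toLp (fun t => ((m t : ℝ) : 𝕜) * g.1 t) g.2
      map_add' := by
        intro g h
        rw [← MemLp.toLp_add]
        apply MemLp.toLp_congr
        filter_upwards [Lp.coeFn_add g.1 h.1] with t ht
        simp only [Submodule.coe_add, Pi.add_apply, ht, mul_add]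
      map_smul' := by
        intro a g
        rw [RingHom.id_apply, ← MemLp.toLp_const_smul]
        apply MemLp.toLp_congr
        filter_upwards [Lp.coeFn_smul a g.1] with t ht
        simp only [Submodule.coe_smul, Pi.smul_apply, ht, smul_eq_mul]
        ring }

namespace NonstandardExtension

variable (E : NonstandardExtension.{u, v}) {𝕜 : Type} {H : Type u} [RCLike 𝕜]
  [NormedAddCommGroup H] [InnerProductSpace 𝕜 H]

/-- The operator `T_L` of multiplication by `m_L` on `H_L = L₂(Ω_L, μ_L)`. The real function used
here differs from `m_L` only where `m_L = ±∞`. -/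
noncomputable def loebOperator (D : E.star (FinModel 𝕜 H)) (S : E.star (FinScale H)) :
    Lp 𝕜 2 (E.loebMeasure D S) →ₗ.[𝕜] Lp 𝕜 2 (E.loebMeasure D S) :=
  mulOperator 𝕜 (E.loebMeasure D S) (fun f => (E.loebMultiplier D S f).toReal)

end NonstandardExtension

/-!
# A partial spectral theorem via Loeb measures

A point `a ∈ *X` determines the ultrafilter `ult a` of all standard sets `s ⊆ X` with `a ∈ *s`, and
finitely many internal objects can be packed into one such point. Through `ult`, a transferred
statement about `a` says that the corresponding standard statement holds eventually, and standard
parts are limits along an ultrafilter (`isSt_map`, `tendsto_stE`). The internal sampling and scale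
are thus handled as families of finite-dimensional models `d q` and finite scales `w q`, for which
the spectral theorem is the eigenvector expansion in an orthonormal basis.

*Loeb measure.* By saturation a countable cover of an internal set by internal sets has a finite
subcover (`exists_subset_biUnion_lt`). Hence the outer measure of an internal set is the standard
part of its internal measure, and finite additivity makes internal sets Carathéodory measurable.
By Parseval's identity the total mass is `∑ c_j ‖e_j‖² = 1`.

*Integration.* Comparison with internal step functions shows that the Loeb integral of the standard
part of an internal function with standard bounds is the standard part of the internal integral
(`lintegral_loebFun_of_bounded`). Truncation gives the inequality `≤` for nonnegative internal
functions (`lintegral_loebFun_le`).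

*The transform.* The internal integral of `|Ũ x|²` is at most `‖x‖²`, by Bessel's inequality. So
`st ∘ Ũ x` exists almost everywhere, its `L₂` norm is at most `‖x‖`, and it does not change if `x` is
replaced by an infinitely close internal vector (`ae_tendsto_transform`). As
`μ̃({f}) ≥ c_j |(e_j, f)|²`, the function `Ũ e_j` is bounded by `1 / √c_j`, which is a finite number for
standard `j`. On the dense span of the vectors `st(e_j)` the transform is therefore bounded, no
mass is lost and `U_L` is isometric there, hence everywhere (`norm_loebTransform`).

*The operator.* The measure of `{|λ| > n}` is at most `∑_{j ≤ J} c_j ‖Ã e_j‖² / n²` plus the mass of the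
scale beyond `J`. The images `Ã e_j` are nearstandard and the tails are small for a standard `J`, so
`m_L` is finite almost everywhere (`ae_loebMultiplier_ne`). Multiplication by a real measurable
function is self-adjoint on its maximal domain (`isSelfAdjoint_mulOperator`). Finally
`Ũ(Ã x) = λ · Ũ x` holds pointwise, and taking standard parts gives `U_L y = m_L · U_L x` for `(x, y)` in
`st(G(Ã))` (`loebTransform_mem_graph`).
-/

open scoped Topology

namespace NonstandardExtension

variable (E : NonstandardExtension.{u, v}) {X Y Z W : Type u}

/-! ### Internal points as ultrafilters -/

variable {E} in
theorem Holds.mono {P Q : X → Prop} {a : E.star X} (h : E.Holds P a) (hPQ : ∀ x, P x → Q x) :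
    E.Holds Q a := by
  obtain ⟨b, rfl⟩ := h
  exact ⟨E.map (fun x : {x // P x} => (⟨x.1, hPQ _ x.2⟩ : {x // Q x})) b, (E.map_comp _ _ b).symm⟩

theorem isEmpty_star [IsEmpty X] : IsEmpty (E.star X) :=
  ⟨fun a => E.star_empty.false (E.map (fun x : X => (isEmptyElim x : PEmpty)) a)⟩

theorem holds_map_of_holds {P : Y → Prop} (g : X → Y) {a : E.star X}
    (h : E.Holds (fun x => P (g x)) a) : E.Holds P (E.map g a) := by
  obtain ⟨b, rfl⟩ := h
  exact ⟨E.map (fun x : {x // P (g x)} => (⟨g x.1, x.2⟩ : {y // P y})) b, by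
    rw [← E.map_comp, ← E.map_comp]⟩

/-- The extension of a complement is the complement of the extension. -/
theorem holds_not {P : X → Prop} {a : E.star X} : E.Holds (fun x => ¬ P x) a ↔ ¬ E.Holds P a := by
  constructor
  · rintro ⟨b', hb'⟩ ⟨b, hb⟩
    -- an element of both would give an element of the extension of the empty type
    have h : E.map (fun z : {x // P x} × {x // ¬ P x} => z.1.1) (E.pair b b') =
        E.map (fun z : {x // P x} × {x // ¬ P x} => z.2.1) (E.pair b b') := by
      rw [E.map_comp Subtype.val Prod.fst, E.map_comp Subtype.val Prod.snd, E.map_fst_pair,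
        E.map_snd_pair, hb, hb']
    obtain ⟨c, -⟩ := E.star_eq _ _ _ h
    have : IsEmpty {z : {x // P x} × {x // ¬ P x} // z.1.1 = z.2.1} :=
      ⟨fun z => z.1.2.2 (z.2 ▸ z.1.1.2)⟩
    exact E.isEmpty_star.false c
  · intro h
    exact (E.star_compl P a).resolve_left h

theorem holds_map {P : Y → Prop} (g : X → Y) {a : E.star X} :
    E.Holds P (E.map g a) ↔ E.Holds (fun x => P (g x)) a := by
  refine ⟨fun h => ?_, E.holds_map_of_holds g⟩
  by_contra h'
  exact E.holds_not.1 (E.holds_map_of_holds (P := fun y => ¬ P y) g (E.holds_not.2 h')) h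

theorem holds_and {P Q : X → Prop} {a : E.star X} (hP : E.Holds P a) (hQ : E.Holds Q a) :
    E.Holds (fun x => P x ∧ Q x) a := by
  obtain ⟨b, rfl⟩ := hP
  rw [holds_map] at hQ ⊢
  exact hQ.mono fun x hx => ⟨x.2, hx⟩

theorem holds_true (a : E.star X) : E.Holds (fun _ => True) a :=
  ⟨E.map (fun x => ⟨x, trivial⟩) a, by rw [← E.map_comp, E.map_id]⟩

/-- The ultrafilter on `X` formed by the standard sets `s ⊆ X` with `a ∈ *s`. Through it,
statements about `a` become statements about limits along an ultrafilter. -/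
def ult (a : E.star X) : Ultrafilter X :=
  Ultrafilter.ofComplNotMemIff
    { sets := {s | E.Holds (fun x => x ∈ s) a}
      univ_sets := E.holds_true a
      sets_of_superset := fun h hs => h.mono hs
      inter_sets := fun h h' => E.holds_and h h' }
    fun _ => by
      change ¬ E.Holds _ a ↔ E.Holds _ a
      rw [← holds_not]
      simp

variable {E}

theorem holds_map_iff {P : Y → Prop} {g : X → Y} {a : E.star X} :
    E.Holds P (E.map g a) ↔ ∀ᶠ x in E.ult a, P (g x) :=
  E.holds_map g

theorem ult_map (g : X → Y) (a : E.star X) :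
    (E.ult (E.map g a) : Filter Y) = Filter.map g (E.ult a) := by
  ext s
  exact E.holds_map g

theorem eq_pair {c : E.star (X × Y)} {a : E.star X} {b : E.star Y} (ha : E.map Prod.fst c = a)
    (hb : E.map Prod.snd c = b) : c = E.pair a b :=
  (E.star_prod X Y).1 (Prod.ext (ha.trans (E.map_fst_pair a b).symm)
    (hb.trans (E.map_snd_pair a b).symm))

theorem pair_map_map (g : X → Y) (h : X → Z) (a : E.star X) :
    E.pair (E.map g a) (E.map h a) = E.map (fun x => (g x, h x)) a :=
  (eq_pair (c := E.map (fun x => (g x, h x)) a) (E.map_comp Prod.fst (fun x => (g x, h x)) a).symm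
    (E.map_comp Prod.snd (fun x => (g x, h x)) a).symm).symm

theorem map_eq_fst (g : X → Z) (a : E.star X) (b : E.star Y) :
    E.map g a = E.map (fun z : X × Y => g z.1) (E.pair a b) := by
  rw [E.map_comp g Prod.fst, E.map_fst_pair]

theorem eq_map_fst (a : E.star X) (b : E.star Y) :
    a = E.map (fun z : X × Y => z.1) (E.pair a b) := (E.map_fst_pair a b).symm

theorem map₂_map (R : Y → Z → W) (g : X → Y) (h : X → Z) (a : E.star X) :
    E.map₂ R (E.map g a) (E.map h a) = E.map (fun x => R (g x) (h x)) a := by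
  rw [map₂, pair_map_map, ← E.map_comp]

theorem map₃_map {W' : Type u} (R : Y → Z → W → W') (g : X → Y) (h : X → Z) (k : X → W)
    (a : E.star X) :
    E.map₃ R (E.map g a) (E.map h a) (E.map k a) = E.map (fun x => R (g x) (h x) (k x)) a := by
  rw [map₃, pair_map_map, pair_map_map, ← E.map_comp]

theorem holds₂_map {R : Y → Z → Prop} {g : X → Y} {h : X → Z} {a : E.star X} :
    E.Holds₂ R (E.map g a) (E.map h a) ↔ ∀ᶠ x in E.ult a, R (g x) (h x) := by
  rw [Holds₂, pair_map_map, holds_map]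
  rfl

theorem holds₃_map {R : Y → Z → W → Prop} {g : X → Y} {h : X → Z} {k : X → W} {a : E.star X} :
    E.Holds₃ R (E.map g a) (E.map h a) (E.map k a) ↔
      ∀ᶠ x in E.ult a, R (g x) (h x) (k x) := by
  rw [Holds₃, pair_map_map, pair_map_map, holds_map]
  rfl

theorem holds₂_pair {R : Y → Z → Prop} {g : X → Y} {a : E.star X} {b : E.star Z} :
    E.Holds₂ R (E.map g a) b ↔ ∀ᶠ z : X × Z in E.ult (E.pair a b), R (g z.1) z.2 := by
  have h := holds₂_map (R := R) (g := fun z : X × Z => g z.1) (h := Prod.snd) (a := E.pair a b)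
  rwa [← map_eq_fst, E.map_snd_pair] at h

theorem mem_map_pair {v : X → Set Y} {a : E.star X} {b : E.star Y} :
    E.Mem b (E.map v a) ↔ ∀ᶠ z : X × Y in E.ult (E.pair a b), z.2 ∈ v z.1 := by
  have h := holds₂_map (R := fun (y : Y) (s : Set Y) => y ∈ s) (g := Prod.snd)
    (h := fun z : X × Y => v z.1) (a := E.pair a b)
  rwa [← map_eq_fst, E.map_snd_pair] at h

theorem eventually_ult_fst {P : X → Prop} {a : E.star X} {b : E.star Y}
    (h : ∀ᶠ x in E.ult a, P x) : ∀ᶠ z : X × Y in E.ult (E.pair a b), P z.1 := by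
  rw [eq_map_fst a b, ult_map] at h
  exact h

/-! ### Standard parts as limits -/

theorem isSt_map {M : Type u} [PseudoMetricSpace M] {g : X → M} {a : E.star X} {x : M} :
    E.IsSt (E.map g a) x ↔ Tendsto g (E.ult a) (𝓝 x) := by
  rw [Metric.tendsto_nhds]
  exact forall₂_congr fun _ _ => E.holds_map g

theorem isSt_map_up {M : Type} [PseudoMetricSpace M] {g : X → M} {a : E.star X} {x : M} :
    E.IsSt (E.map (fun z => ULift.up.{u} (g z)) a) (ULift.up x) ↔ Tendsto g (E.ult a) (𝓝 x) := by
  rw [Metric.tendsto_nhds]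
  exact forall₂_congr fun _ _ => E.holds_map _

theorem st_map_up {𝕜 : Type} [RCLike 𝕜] {g : X → 𝕜} {a : E.star X} {x : 𝕜}
    (h : Tendsto g (E.ult a) (𝓝 x)) : E.st (E.map (fun z => ULift.up.{u} (g z)) a) = x := by
  have h' : ∃ z : 𝕜, E.IsSt (E.map (fun z => ULift.up.{u} (g z)) a) (ULift.up z) :=
    ⟨x, isSt_map_up.2 h⟩
  rw [st, dif_pos h']
  exact tendsto_nhds_unique (isSt_map_up.1 h'.choose_spec) h

/-- The standard part in `[-∞, ∞]` is a limit along the ultrafilter; it exists by compactness. -/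
theorem tendsto_stE (g : X → ℝ) (a : E.star X) :
    Tendsto (fun x => (g x : EReal)) (E.ult a)
      (𝓝 (E.stE (E.map (fun z => ULift.up.{u} (g z)) a))) := by
  obtain ⟨L, -, hL⟩ := isCompact_univ.ultrafilter_le_nhds
    ((E.ult a).map (fun x => (g x : EReal))) (by simp)
  have hL : Tendsto (fun x => (g x : EReal)) (E.ult a) (𝓝 L) := hL
  convert hL
  refine le_antisymm (sSup_le ?_) (le_of_forall_lt fun c hc => ?_)
  · rintro _ ⟨t, rfl, ht⟩
    refine ge_of_tendsto hL ?_
    have ht' : ∀ᶠ x in E.ult a, t < g x := holds_map_iff.1 ht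
    filter_upwards [ht'] with x hx using EReal.coe_le_coe_iff.2 hx.le
  · obtain ⟨t, h1, h2⟩ := EReal.exists_between_coe_real hc
    refine h1.trans_le (le_sSup ⟨t, rfl, (E.holds_map _).2 ?_⟩)
    have := hL.eventually (lt_mem_nhds h2)
    exact this.mono fun x hx => EReal.coe_lt_coe_iff.1 hx

theorem stE_map_up {g : X → ℝ} {a : E.star X} {L : EReal}
    (h : Tendsto (fun x => (g x : EReal)) (E.ult a) (𝓝 L)) :
    E.stE (E.map (fun z => ULift.up.{u} (g z)) a) = L :=
  tendsto_nhds_unique (tendsto_stE g a) h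

theorem exists_tendsto_of_eventually_norm_le {M : Type*} [SeminormedAddCommGroup M] [ProperSpace M]
    {U : Ultrafilter X} {g : X → M} {C : ℝ} (h : ∀ᶠ x in U, ‖g x‖ ≤ C) :
    ∃ y, Tendsto g U (𝓝 y) := by
  obtain ⟨y, -, hy⟩ := (isCompact_closedBall (0 : M) C).ultrafilter_le_nhds (U.map g) (by
    simp only [Ultrafilter.coe_map, le_principal_iff, Filter.mem_map]
    filter_upwards [h] with x hx
    simpa using hx)
  exact ⟨y, hy⟩

end NonstandardExtension

/-! ### Finite-dimensional models -/

namespace FinModel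

variable {𝕜 : Type} {H : Type*} [RCLike 𝕜] [NormedAddCommGroup H] [InnerProductSpace 𝕜 H]
  (d : FinModel 𝕜 H) (w : FinScale H)

theorem mem_V {f : H} (hf : f ∈ d.Ω) : f ∈ d.V :=
  d.span_eq ▸ Submodule.subset_span (Finset.mem_coe.2 hf)

theorem bessel (x : H) : ∑ f ∈ d.Ω, ‖⟪f, x⟫_𝕜‖ ^ 2 ≤ ‖x‖ ^ 2 := by
  have h := d.orthonormal.sum_inner_products_le x (s := Finset.univ)
  rwa [Finset.univ_eq_attach, Finset.sum_attach d.Ω fun f => ‖⟪f, x⟫_𝕜‖ ^ 2] at h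

theorem parseval {x : H} (hx : x ∈ d.V) : ∑ f ∈ d.Ω, ‖⟪f, x⟫_𝕜‖ ^ 2 = ‖x‖ ^ 2 := by
  classical
  have hon : Orthonormal 𝕜 (fun f : d.Ω => (⟨f, d.mem_V f.2⟩ : d.V)) := by
    have h := d.orthonormal
    rw [orthonormal_iff_ite] at h ⊢
    exact h
  have hsp : ⊤ ≤ Submodule.span 𝕜 (Set.range fun f : d.Ω => (⟨f, d.mem_V f.2⟩ : d.V)) := by
    intro y _
    have hy : (y : H) ∈ Submodule.span 𝕜 (d.Ω : Set H) := d.span_eq.symm ▸ y.2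
    have : (d.Ω : Set H) =
        d.V.subtype '' (Set.range fun f : d.Ω => (⟨f, d.mem_V f.2⟩ : d.V)) := by
      ext f
      simpa using fun hf => d.mem_V hf
    rw [this, Submodule.span_image] at hy
    obtain ⟨z, hz, hzy⟩ := hy
    rwa [← Subtype.ext hzy]
  have h := (OrthonormalBasis.mk hon hsp).sum_sq_norm_inner_right ⟨x, hx⟩
  simp only [OrthonormalBasis.coe_mk, Finset.univ_eq_attach, Submodule.coe_inner,
    Submodule.coe_norm] at h
  rwa [Finset.sum_attach d.Ω fun f => ‖⟪f, x⟫_𝕜‖ ^ 2] at h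

/-- The mass `∑_j c_j |(e_j, f)|²` of a basis vector `f`. -/
noncomputable def weight (f : H) : ℝ := ∑ j ∈ Finset.Icc 1 w.N, w.c j * ‖⟪f, w.e j⟫_𝕜‖ ^ 2

theorem weight_nonneg (f : H) : 0 ≤ weight (𝕜 := 𝕜) w f :=
  Finset.sum_nonneg fun j hj => mul_nonneg (w.c_nonneg j hj) (by positivity)

theorem weight_pos {f : H} (h : ∃ j ∈ Finset.Icc 1 w.N, 0 < w.c j ∧ ⟪f, w.e j⟫_𝕜 ≠ 0) :
    0 < weight (𝕜 := 𝕜) w f := by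
  obtain ⟨j, hj, hc, he⟩ := h
  refine lt_of_lt_of_le ?_ (Finset.single_le_sum (f := fun j => w.c j * ‖⟪f, w.e j⟫_𝕜‖ ^ 2)
    (fun j hj => mul_nonneg (w.c_nonneg j hj) (by positivity)) hj)
  have := norm_pos_iff.2 he
  positivity

open Classical in
theorem meas_eq_sum (s : Set H) : d.meas w s = ∑ f ∈ d.Ω with f ∈ s, weight (𝕜 := 𝕜) w f := by
  simp only [meas, weight, Finset.mul_sum]
  rw [Finset.sum_comm]

theorem meas_singleton {f : H} (hf : f ∈ d.Ω) : d.meas w {f} = weight (𝕜 := 𝕜) w f := by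
  classical
  rw [meas_eq_sum]
  have : ({g ∈ d.Ω | g ∈ ({f} : Set H)} : Finset H) = {f} := by
    ext g
    simp only [Finset.mem_filter, Set.mem_singleton_iff, Finset.mem_singleton]
    exact ⟨fun h => h.2, fun h => ⟨h ▸ hf, h⟩⟩
  rw [← Finset.sum_singleton (weight (𝕜 := 𝕜) w) f, ← this]
  congr!

theorem meas_nonneg (s : Set H) : 0 ≤ d.meas w s := by
  rw [meas_eq_sum]
  exact Finset.sum_nonneg fun f _ => weight_nonneg w f

theorem meas_mono {s t : Set H} (h : ∀ f ∈ d.Ω, f ∈ s → f ∈ t) : d.meas w s ≤ d.meas w t := by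
  classical
  rw [meas_eq_sum, meas_eq_sum]
  refine Finset.sum_le_sum_of_subset_of_nonneg (fun f hf => ?_) fun f _ _ => weight_nonneg w f
  rw [Finset.mem_filter] at hf ⊢
  exact ⟨hf.1, h f hf.1 hf.2⟩

theorem meas_inter_add_diff (s t : Set H) : d.meas w (s ∩ t) + d.meas w (s \ t) = d.meas w s := by
  classical
  simp only [meas_eq_sum, Finset.sum_filter, ← Finset.sum_add_distrib, Set.mem_inter_iff,
    Set.mem_sdiff]
  refine Finset.sum_congr rfl fun f _ => ?_
  by_cases hs : f ∈ s <;> by_cases ht : f ∈ t <;> simp [hs, ht]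

theorem meas_union_le (s t : Set H) : d.meas w (s ∪ t) ≤ d.meas w s + d.meas w t := by
  rw [← d.meas_inter_add_diff w (s ∪ t) s]
  exact add_le_add (d.meas_mono w fun _ _ h => h.2)
    (d.meas_mono w fun _ _ h => h.1.resolve_left h.2)

theorem meas_empty : d.meas w ∅ = 0 := by
  simp [meas]

theorem meas_univ (he : ∀ j ∈ Finset.Icc 1 w.N, w.e j ∈ d.V) :
    d.meas w Set.univ = ∑ j ∈ Finset.Icc 1 w.N, w.c j * ‖w.e j‖ ^ 2 := by
  refine Finset.sum_congr rfl fun j hj => ?_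
  rw [← d.parseval (he j hj)]
  simp

open Classical in
/-- Integration of a step function against the finite measure `meas`. -/
theorem sum_mul_meas_eq_sum_weight (K : ℕ) (δ : ℝ) (s : ℕ → Set H) :
    ∑ k ∈ Finset.range K, δ * d.meas w (s k) =
      ∑ f ∈ d.Ω, (∑ k ∈ Finset.range K, if f ∈ s k then δ else 0) * weight (𝕜 := 𝕜) w f := by
  simp only [meas_eq_sum, Finset.mul_sum, Finset.sum_mul, Finset.sum_filter]
  rw [Finset.sum_comm]
  refine Finset.sum_congr rfl fun f _ => Finset.sum_congr rfl fun k _ => ?_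
  split_ifs <;> simp

theorem sum_weight : ∑ f ∈ d.Ω, weight (𝕜 := 𝕜) w f = d.meas w Set.univ := by
  simp [meas_eq_sum]

theorem norm_transform_sq {f : H} (hf : f ∈ d.Ω) (x : H) :
    ‖d.transform w x f‖ ^ 2 = ‖⟪f, x⟫_𝕜‖ ^ 2 / weight (𝕜 := 𝕜) w f := by
  rw [transform, norm_div, div_pow, RCLike.norm_ofReal, sq_abs,
    Real.sq_sqrt (d.meas_nonneg w _), d.meas_singleton w hf]

theorem norm_transform_sq_mul_weight {f : H} (hf : f ∈ d.Ω) (hw : 0 < weight (𝕜 := 𝕜) w f) (x : H) :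
    ‖d.transform w x f‖ ^ 2 * weight (𝕜 := 𝕜) w f = ‖⟪f, x⟫_𝕜‖ ^ 2 := by
  rw [d.norm_transform_sq w hf, div_mul_cancel₀ _ hw.ne']

theorem sum_norm_transform_sq_le (x : H) (hw : ∀ f ∈ d.Ω, 0 < weight (𝕜 := 𝕜) w f) :
    ∑ f ∈ d.Ω, ‖d.transform w x f‖ ^ 2 * weight (𝕜 := 𝕜) w f ≤ ‖x‖ ^ 2 := by
  rw [Finset.sum_congr rfl fun f hf => d.norm_transform_sq_mul_weight w hf (hw f hf) x]
  exact d.bessel x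

theorem sum_norm_transform_sq {x : H} (hx : x ∈ d.V) (hw : ∀ f ∈ d.Ω, 0 < weight (𝕜 := 𝕜) w f) :
    ∑ f ∈ d.Ω, ‖d.transform w x f‖ ^ 2 * weight (𝕜 := 𝕜) w f = ‖x‖ ^ 2 := by
  rw [Finset.sum_congr rfl fun f hf => d.norm_transform_sq_mul_weight w hf (hw f hf) x]
  exact d.parseval hx

theorem transform_add (x y f : H) :
    d.transform w (x + y) f = d.transform w x f + d.transform w y f := by
  simp only [transform, inner_add_right, add_div]

theorem transform_sub (x y f : H) :
    d.transform w (x - y) f = d.transform w x f - d.transform w y f := by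
  simp only [transform, inner_sub_right, sub_div]

theorem transform_smul (a : 𝕜) (x f : H) : d.transform w (a • x) f = a * d.transform w x f := by
  simp only [transform, inner_smul_right, mul_div_assoc]

/-- The transform of a vector `e_j` of the scale is bounded by `1 / √c_j`. -/
theorem norm_transform_e_sq_le {f : H} (hf : f ∈ d.Ω) {j : ℕ} (hj : j ∈ Finset.Icc 1 w.N)
    (hc : 0 < w.c j) : ‖d.transform w (w.e j) f‖ ^ 2 ≤ 1 / w.c j := by
  rw [d.norm_transform_sq w hf]
  have h : w.c j * ‖⟪f, w.e j⟫_𝕜‖ ^ 2 ≤ weight (𝕜 := 𝕜) w f :=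
    Finset.single_le_sum (f := fun j => w.c j * ‖⟪f, w.e j⟫_𝕜‖ ^ 2)
      (fun j hj => mul_nonneg (w.c_nonneg j hj) (by positivity)) hj
  rcases (weight_nonneg (𝕜 := 𝕜) w f).eq_or_lt with h0 | h0
  · rw [← h0, div_zero]
    positivity
  · rw [div_le_div_iff₀ h0 hc]
    linarith

variable {d} in
theorem InGraph.inner_eq {x y f : H} (h : d.InGraph x y) (hf : f ∈ d.Ω) :
    ⟪f, y⟫_𝕜 = ((d.eigenvalue f : ℝ) : 𝕜) * ⟪f, x⟫_𝕜 := by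
  obtain ⟨hx, rfl⟩ := h
  obtain ⟨hfV, hTf⟩ := d.inGraph_eigenvalue hf
  have h1 := d.symm ⟨f, hfV⟩ ⟨x, hx⟩
  rw [Submodule.coe_inner, Submodule.coe_inner, hTf, inner_smul_left, RCLike.conj_ofReal] at h1
  exact h1.symm

variable {d} in
/-- The transform diagonalizes the operator. -/
theorem InGraph.transform_eq {x y f : H} (h : d.InGraph x y) (hf : f ∈ d.Ω) :
    d.transform w y f = ((d.eigenvalue f : ℝ) : 𝕜) * d.transform w x f := by
  rw [transform, transform, h.inner_eq hf, mul_div_assoc]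

variable {d} in
theorem InGraph.sum_eigenvalue_sq_mul {x y : H} (h : d.InGraph x y) :
    ∑ f ∈ d.Ω, d.eigenvalue f ^ 2 * ‖⟪f, x⟫_𝕜‖ ^ 2 = ‖y‖ ^ 2 := by
  have hy : y ∈ d.V := by
    obtain ⟨hx, rfl⟩ := h
    exact Subtype.mem _
  rw [← d.parseval hy]
  refine Finset.sum_congr rfl fun f hf => ?_
  rw [h.inner_eq hf, norm_mul, mul_pow, RCLike.norm_ofReal, sq_abs]

/-- Chebyshev's inequality for the eigenvalues: the first `J` terms of the measure are controlled
by `λ² / n² ≥ 1`, the remaining ones by the tail of the scale. -/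
theorem meas_large_eigenvalue_le {n : ℝ} (hn : 0 < n) {J : ℕ} (hJ : J ≤ w.N) :
    d.meas w {f | n < |d.eigenvalue f|} ≤
      (∑ j ∈ Finset.Icc 1 J, w.c j * ∑ f ∈ d.Ω, d.eigenvalue f ^ 2 * ‖⟪f, w.e j⟫_𝕜‖ ^ 2) / n ^ 2 +
        ∑ j ∈ Finset.Icc 1 w.N with J < j, w.c j * ‖w.e j‖ ^ 2 := by
  classical
  have hsplit : ({j ∈ Finset.Icc 1 w.N | ¬ J < j} : Finset ℕ) = Finset.Icc 1 J := by
    ext j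
    simp only [Finset.mem_filter, Finset.mem_Icc]
    omega
  rw [meas, ← Finset.sum_filter_not_add_sum_filter (Finset.Icc 1 w.N) (J < ·), hsplit,
    Finset.sum_div]
  refine add_le_add (Finset.sum_le_sum fun j hj => ?_) (Finset.sum_le_sum fun j hj => ?_)
  · have hj' : j ∈ Finset.Icc 1 w.N := by
      rw [Finset.mem_Icc] at hj ⊢
      omega
    rw [mul_div_assoc]
    refine mul_le_mul_of_nonneg_left ?_ (w.c_nonneg j hj')
    rw [Finset.sum_div, Finset.sum_filter]
    refine Finset.sum_le_sum fun f _ => ?_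
    split_ifs with h
    · rw [Set.mem_ofPred_eq] at h
      have h2 : n ^ 2 ≤ d.eigenvalue f ^ 2 := by
        rw [← sq_abs (d.eigenvalue f)]
        gcongr
      rw [le_div_iff₀ (by positivity), mul_comm]
      gcongr
    · positivity
  · refine mul_le_mul_of_nonneg_left ?_ (w.c_nonneg j (Finset.mem_filter.1 hj).1)
    refine (Finset.sum_le_sum_of_subset_of_nonneg (Finset.filter_subset _ _) ?_).trans
      (d.bessel (w.e j))
    intros
    positivity

end FinModel

namespace NonstandardExtension

variable {E : NonstandardExtension.{u, v}} {𝕜 : Type} {H X : Type u} [RCLike 𝕜]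
  [NormedAddCommGroup H] [InnerProductSpace 𝕜 H]
  {D : E.star (FinModel 𝕜 H)} {S : E.star (FinScale H)}

/-! ### Internal subsets of the Loeb space -/

/-- The point of `*H` underlying a point of the Loeb space. -/
def LoebSpace.val (f : E.LoebSpace D S) : E.star H := Subtype.val f

variable (S) in
/-- A point of `Ω̃` as a point of the Loeb space. -/
def LoebSpace.mk (f : E.star H) (hf : E.Holds₂ (fun (d : FinModel 𝕜 H) f => f ∈ d.Ω) D f) :
    E.LoebSpace D S := ⟨f, hf⟩

section Transfer

variable {a : E.star X} {d : X → FinModel 𝕜 H} {w : X → FinScale H}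

theorem LoebSpace.eventually_mem (f : E.LoebSpace D S) (hd : E.map d a = D) :
    ∀ᶠ z : X × H in E.ult (E.pair a f.val), z.2 ∈ (d z.1).Ω := by
  subst hd
  exact holds₂_pair.1 f.2

/-- Transfer of a universal quantifier over `Ω̃`. -/
theorem forall_loebSpace_iff (S : E.star (FinScale H)) (hd : E.map d a = D) {R : X → H → Prop} :
    (∀ f : E.LoebSpace D S, ∀ᶠ z : X × H in E.ult (E.pair a f.val), R z.1 z.2) ↔
      ∀ᶠ q in E.ult a, ∀ f ∈ (d q).Ω, R q f := by
  constructor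
  · intro h
    by_contra h'
    rw [← Ultrafilter.eventually_not] at h'
    have h'' : ∀ᶠ q in E.ult a, ∃ f, f ∈ (d q).Ω ∧ ¬ R q f := by
      filter_upwards [h'] with q hq
      push Not at hq
      exact hq
    -- a choice of counterexamples is an internal point of `Ω̃` at which `R` fails
    obtain ⟨g, hg⟩ := h''.choice
    let f : E.LoebSpace D S := LoebSpace.mk S (E.map g a) (by
      rw [← hd, holds₂_map]
      exact hg.mono fun q hq => hq.1)
    have hp : E.pair a f.val = E.map (fun q => (q, g q)) a := by
      conv_lhs => rw [← E.map_id X a]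
      exact pair_map_map _ _ _
    have h1 := h f
    rw [hp, ult_map, eventually_map] at h1
    obtain ⟨q, hq1, hq2⟩ := (h1.and hg).exists
    exact hq2.2 hq1
  · intro h f
    filter_upwards [f.eventually_mem hd, eventually_ult_fst (b := f.val) h] with z hz1 hz2
    exact hz2 _ hz1

theorem mem_internalSet_map {v : X → Set H} {f : E.LoebSpace D S} :
    f ∈ E.internalSet D S (E.map v a) ↔ ∀ᶠ z : X × H in E.ult (E.pair a f.val), z.2 ∈ v z.1 :=
  mem_map_pair

theorem internalSet_map_subset_iff (hd : E.map d a = D) {v v' : X → Set H} :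
    E.internalSet D S (E.map v a) ⊆ E.internalSet D S (E.map v' a) ↔
      ∀ᶠ q in E.ult a, ∀ f ∈ (d q).Ω, f ∈ v q → f ∈ v' q := by
  rw [← forall_loebSpace_iff S hd (R := fun q f => f ∈ v q → f ∈ v' q)]
  refine forall_congr' fun f => ?_
  rw [mem_internalSet_map, mem_internalSet_map, Ultrafilter.eventually_imp]

variable (E D S) in
/-- The standard part of the internal measure of an internal set. -/
noncomputable def loebContent (V : E.star (Set H)) : ℝ≥0∞ :=
  (E.stE (E.internalMeasure D S V)).toENNReal

theorem tendsto_loebContent (hd : E.map d a = D) (hw : E.map w a = S) (v : X → Set H) :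
    Tendsto (fun q => ENNReal.ofReal ((d q).meas (w q) (v q))) (E.ult a)
      (𝓝 (E.loebContent D S (E.map v a))) := by
  rw [loebContent, internalMeasure, ← hd, ← hw, map₃_map]
  have h := (EReal.continuous_toENNReal.tendsto _).comp
    (tendsto_stE (fun q => (d q).meas (w q) (v q)) a)
  refine h.congr fun q => ?_
  simp

/-- The sampling, the scale and two further internal points depend on one internal parameter. -/
theorem exists_param (D : E.star (FinModel 𝕜 H)) (S : E.star (FinScale H)) {Y : Type u}
    (V W : E.star Y) : ∃ (X : Type u) (a : E.star X) (d : X → FinModel 𝕜 H) (w : X → FinScale H)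
      (v v' : X → Y), E.map d a = D ∧ E.map w a = S ∧ E.map v a = V ∧ E.map v' a = W :=
  ⟨(FinModel 𝕜 H × FinScale H) × Y × Y, E.pair (E.pair D S) (E.pair V W), fun z => z.1.1,
    fun z => z.1.2, fun z => z.2.1, fun z => z.2.2,
    by rw [E.map_comp Prod.fst Prod.fst, E.map_fst_pair, E.map_fst_pair],
    by rw [E.map_comp Prod.snd Prod.fst, E.map_fst_pair, E.map_snd_pair],
    by rw [E.map_comp Prod.fst Prod.snd, E.map_snd_pair, E.map_fst_pair],
    by rw [E.map_comp Prod.snd Prod.snd, E.map_snd_pair, E.map_snd_pair]⟩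

theorem loebContent_mono {V W : E.star (Set H)}
    (h : E.internalSet D S V ⊆ E.internalSet D S W) :
    E.loebContent D S V ≤ E.loebContent D S W := by
  obtain ⟨X, a, d, w, v, v', hd, hw, rfl, rfl⟩ := exists_param D S V W
  rw [internalSet_map_subset_iff hd] at h
  refine le_of_tendsto_of_tendsto (tendsto_loebContent hd hw _) (tendsto_loebContent hd hw _) ?_
  filter_upwards [h] with q hq
  exact ENNReal.ofReal_le_ofReal (FinModel.meas_mono _ _ hq)

end Transfer

theorem exists_internalSet_union (V W : E.star (Set H)) :
    ∃ U, E.internalSet D S U = E.internalSet D S V ∪ E.internalSet D S W ∧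
      E.loebContent D S U ≤ E.loebContent D S V + E.loebContent D S W := by
  obtain ⟨X, a, d, w, v, v', hd, hw, rfl, rfl⟩ := exists_param D S V W
  refine ⟨E.map (fun q => v q ∪ v' q) a, ?_, ?_⟩
  · ext f
    rw [Set.mem_union, mem_internalSet_map, mem_internalSet_map, mem_internalSet_map,
      ← Ultrafilter.eventually_or]
    rfl
  · refine le_of_tendsto_of_tendsto (tendsto_loebContent hd hw _)
      ((tendsto_loebContent hd hw v).add (tendsto_loebContent hd hw v')) (Eventually.of_forall ?_)
    intro q
    change _ ≤ _ + _
    rw [← ENNReal.ofReal_add (FinModel.meas_nonneg _ _ _) (FinModel.meas_nonneg _ _ _)]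
    exact ENNReal.ofReal_le_ofReal (FinModel.meas_union_le _ _ _ _)

theorem exists_internalSet_inter_diff (V W : E.star (Set H)) :
    ∃ U U', E.internalSet D S U = E.internalSet D S V ∩ E.internalSet D S W ∧
      E.internalSet D S U' = E.internalSet D S V \ E.internalSet D S W ∧
      E.loebContent D S U + E.loebContent D S U' = E.loebContent D S V := by
  obtain ⟨X, a, d, w, v, v', hd, hw, rfl, rfl⟩ := exists_param D S V W
  refine ⟨E.map (fun q => v q ∩ v' q) a, E.map (fun q => v q \ v' q) a, ?_, ?_, ?_⟩
  · ext f
    rw [Set.mem_inter_iff, mem_internalSet_map, mem_internalSet_map, mem_internalSet_map,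
      ← eventually_and]
    rfl
  · ext f
    rw [Set.mem_sdiff, mem_internalSet_map, mem_internalSet_map, mem_internalSet_map,
      ← Ultrafilter.eventually_not, ← eventually_and]
    rfl
  · refine tendsto_nhds_unique ((tendsto_loebContent hd hw fun q => v q ∩ v' q).add
      (tendsto_loebContent hd hw fun q => v q \ v' q))
      ((tendsto_loebContent hd hw v).congr fun q => ?_)
    rw [← ENNReal.ofReal_add (FinModel.meas_nonneg _ _ _) (FinModel.meas_nonneg _ _ _),
      FinModel.meas_inter_add_diff]

theorem exists_internalSet_empty :
    ∃ U, E.internalSet D S U = ∅ ∧ E.loebContent D S U = 0 := by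
  obtain ⟨X, a, d, w, -, -, hd, hw, -, -⟩ := exists_param D S D D
  refine ⟨E.map (fun q => ∅) a, ?_, ?_⟩
  · ext f
    rw [mem_internalSet_map]
    simp [(E.ult (E.pair a f.val)).neBot.ne]
  · refine tendsto_nhds_unique (tendsto_loebContent hd hw fun q => ∅) ?_
    simp [FinModel.meas_empty]

theorem exists_internalSet_univ
    (h1 : E.Holds₂ (fun (d : FinModel 𝕜 H) w => d.meas w Set.univ = 1) D S) :
    ∃ U, E.internalSet D S U = Set.univ ∧ E.loebContent D S U = 1 := by
  obtain ⟨X, a, d, w, -, -, rfl, rfl, -, -⟩ := exists_param D S D D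
  refine ⟨E.map (fun q => Set.univ) a, ?_, ?_⟩
  · ext f
    rw [mem_internalSet_map]
    simp
  · rw [holds₂_map] at h1
    refine tendsto_nhds_unique (tendsto_loebContent rfl rfl fun q => Set.univ) ?_
    refine (tendsto_congr' ?_).2 tendsto_const_nhds
    filter_upwards [h1] with q hq
    rw [hq, ENNReal.ofReal_one]

theorem exists_internalSet_biUnion (V : ℕ → E.star (Set H)) (n : ℕ) :
    ∃ U, E.internalSet D S U = ⋃ k < n, E.internalSet D S (V k) ∧
      E.loebContent D S U ≤ ∑ k ∈ Finset.range n, E.loebContent D S (V k) := by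
  induction n with
  | zero =>
    obtain ⟨U, h1, h2⟩ := exists_internalSet_empty (D := D) (S := S)
    exact ⟨U, by simp [h1], by simp [h2]⟩
  | succ n ih =>
    obtain ⟨U, h1, h2⟩ := ih
    obtain ⟨U', h1', h2'⟩ := exists_internalSet_union (D := D) (S := S) U (V n)
    refine ⟨U', by rw [h1', h1, Set.biUnion_lt_succ], h2'.trans ?_⟩
    rw [Finset.sum_range_succ]
    gcongr

/-- By saturation, a countable cover of an internal set by internal sets has a finite subcover. -/
theorem exists_subset_biUnion_lt (hE : E.CountablySaturatedAt H) {V : E.star (Set H)}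
    {W : ℕ → E.star (Set H)} (h : E.internalSet D S V ⊆ ⋃ n, E.internalSet D S (W n)) :
    ∃ n, E.internalSet D S V ⊆ ⋃ k < n, E.internalSet D S (W k) := by
  by_contra hcon
  push Not at hcon
  -- the internal sets `Ω̃ ∩ V \ W n`, which have the finite intersection property
  let B : ℕ → E.star (Set H) := fun n =>
    E.map₃ (fun (d : FinModel 𝕜 H) (s t : Set H) => {f | f ∈ d.Ω ∧ f ∈ s ∧ f ∉ t}) D V (W n)
  have hB : ∀ n f, E.Mem f (B n) ↔ ∃ hf : E.Holds₂ (fun (d : FinModel 𝕜 H) f => f ∈ d.Ω) D f,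
      LoebSpace.mk S f hf ∈ E.internalSet D S V \ E.internalSet D S (W n) := by
    intro n f
    obtain ⟨X, a, d, w, v, v', hd, hw, hV, hW⟩ := exists_param D S V (W n)
    have h1 : B n = E.map (fun q => {f | f ∈ (d q).Ω ∧ f ∈ v q ∧ f ∉ v' q}) a := by
      rw [← map₃_map (fun (d : FinModel 𝕜 H) (s t : Set H) => {f | f ∈ d.Ω ∧ f ∈ s ∧ f ∉ t})
        d v v' a, hd, hV, hW]
    rw [h1, ← hV, ← hW, ← hd]
    rw [mem_map_pair]
    constructor
    · intro hf
      have hf' : E.Holds₂ (fun (d : FinModel 𝕜 H) f => f ∈ d.Ω) (E.map d a) f := by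
        rw [holds₂_pair]
        exact hf.mono fun z hz => hz.1
      refine ⟨hf', ?_⟩
      rw [Set.mem_sdiff, mem_internalSet_map, mem_internalSet_map, ← Ultrafilter.eventually_not]
      exact ⟨hf.mono fun z hz => hz.2.1, hf.mono fun z hz => hz.2.2⟩
    · rintro ⟨hf', hf⟩
      rw [Set.mem_sdiff, mem_internalSet_map, mem_internalSet_map,
        ← Ultrafilter.eventually_not] at hf
      filter_upwards [(LoebSpace.mk S f hf').eventually_mem rfl, hf.1, hf.2] with z h1 h2 h3
      exact ⟨h1, h2, h3⟩
  obtain ⟨f, hf⟩ := hE B fun n => by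
    obtain ⟨f, hf1, hf2⟩ := Set.not_subset.1 (hcon (n + 1))
    simp only [Set.mem_iUnion, not_exists] at hf2
    exact ⟨f.1, fun k hk => (hB k f.val).2 ⟨f.2, hf1, hf2 k (Nat.lt_succ_of_le hk)⟩⟩
  obtain ⟨hf0, hf1⟩ := (hB 0 f).1 (hf 0)
  obtain ⟨n, hn⟩ := Set.mem_iUnion.1 (h hf1.1)
  obtain ⟨_, hf2⟩ := (hB n f).1 (hf n)
  exact hf2.2 hn

/-! ### The Loeb measure -/

variable (E D S) in
/-- The infimum of the contents of the internal sets covering `B`. -/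
noncomputable def coverContent (B : Set (E.LoebSpace D S)) : ℝ≥0∞ :=
  ⨅ (V : E.star (Set H)) (_ : B ⊆ E.internalSet D S V), E.loebContent D S V

theorem coverContent_le {B : Set (E.LoebSpace D S)} {V : E.star (Set H)}
    (h : B ⊆ E.internalSet D S V) : E.coverContent D S B ≤ E.loebContent D S V :=
  iInf₂_le V h

theorem exists_loebContent_le_add (h1 : ∃ U, E.internalSet D S U = Set.univ)
    (B : Set (E.LoebSpace D S)) {ε : ℝ≥0∞} (hε : ε ≠ 0) : ∃ V, B ⊆ E.internalSet D S V ∧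
      E.loebContent D S V ≤ E.coverContent D S B + ε := by
  rcases eq_or_ne (E.coverContent D S B) ⊤ with h | h
  · obtain ⟨U, hU⟩ := h1
    exact ⟨U, by simp [hU], by simp [h]⟩
  · have hlt : E.coverContent D S B < E.coverContent D S B + ε := ENNReal.lt_add_right h hε
    conv_lhs at hlt => rw [coverContent]
    simp only [iInf_lt_iff] at hlt
    obtain ⟨V, hV, hlt⟩ := hlt
    exact ⟨V, hV, hlt.le⟩

/-- The Loeb outer measure extends the content of internal sets: a countable cover can be enlarged
to one by internal sets, of which finitely many suffice. -/
theorem loebOuter_internalSet (hE : E.CountablySaturatedAt H)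
    (h1 : ∃ U, E.internalSet D S U = Set.univ) (V : E.star (Set H)) :
    E.loebOuter D S (E.internalSet D S V) = E.loebContent D S V := by
  have h0 : E.coverContent D S ∅ = 0 := by
    obtain ⟨U, -, hU⟩ := exists_internalSet_empty (D := D) (S := S)
    exact le_antisymm ((coverContent_le (Set.empty_subset _)).trans hU.le) bot_le
  refine le_antisymm ((OuterMeasure.boundedBy_le _).trans (coverContent_le le_rfl)) ?_
  change _ ≤ OuterMeasure.boundedBy (E.coverContent D S) _
  rw [OuterMeasure.boundedBy_eq_ofFunction h0, OuterMeasure.ofFunction_apply]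
  refine le_iInf₂ fun t ht => ENNReal.le_of_forall_pos_le_add fun ε hε _ => ?_
  obtain ⟨ε', hε', hsum⟩ := ENNReal.exists_pos_sum_of_countable
    (ENNReal.coe_ne_zero.2 hε.ne') ℕ
  choose W hW1 hW2 using fun n => exists_loebContent_le_add h1 (t n)
    (ENNReal.coe_ne_zero.2 (hε' n).ne')
  obtain ⟨n, hn⟩ := exists_subset_biUnion_lt hE
    (ht.trans (Set.iUnion_mono hW1))
  obtain ⟨U, hU1, hU2⟩ := exists_internalSet_biUnion (D := D) (S := S) W n
  calc E.loebContent D S V ≤ E.loebContent D S U := loebContent_mono (hn.trans hU1.ge)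
    _ ≤ ∑ k ∈ Finset.range n, E.loebContent D S (W k) := hU2
    _ ≤ ∑' k, E.loebContent D S (W k) := ENNReal.sum_le_tsum _
    _ ≤ ∑' k, (E.coverContent D S (t k) + ε' k) := ENNReal.tsum_le_tsum hW2
    _ = ∑' k, E.coverContent D S (t k) + ∑' k, (ε' k : ℝ≥0∞) := ENNReal.tsum_add
    _ ≤ ∑' k, E.coverContent D S (t k) + ε := by gcongr

theorem measurableSet_internalSet (V : E.star (Set H)) :
    MeasurableSet (E.internalSet D S V) := by
  refine OuterMeasure.boundedBy_caratheodory fun t => le_iInf₂ fun W hW => ?_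
  obtain ⟨U, U', h1, h2, h3⟩ := exists_internalSet_inter_diff (D := D) (S := S) W V
  refine le_trans (add_le_add (coverContent_le (V := U) ?_) (coverContent_le (V := U') ?_)) h3.le
  · rw [h1]
    exact Set.inter_subset_inter_left _ hW
  · rw [h2]
    exact Set.sdiff_subset_sdiff_left hW

theorem loebMeasure_internalSet (hE : E.CountablySaturatedAt H)
    (h1 : ∃ U, E.internalSet D S U = Set.univ) (V : E.star (Set H)) :
    E.loebMeasure D S (E.internalSet D S V) = E.loebContent D S V := by
  rw [loebMeasure, toMeasure_apply _ _ (measurableSet_internalSet V),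
    loebOuter_internalSet hE h1]

instance isComplete_loebMeasure : (E.loebMeasure D S).IsComplete where
  out' s hs := by
    have h0 : E.loebOuter D S s = 0 := le_antisymm ((le_toMeasure_apply _ _ s).trans hs.le) bot_le
    refine (OuterMeasure.isCaratheodory_iff_le' _).2 fun t => ?_
    have h2 : E.loebOuter D S (t ∩ s) = 0 :=
      le_antisymm ((measure_mono Set.inter_subset_right).trans h0.le) bot_le
    rw [h2, zero_add]
    exact measure_mono Set.sdiff_subset

theorem isProbabilityMeasure_loebMeasure (hE : E.CountablySaturatedAt H)
    (h1 : E.Holds₂ (fun (d : FinModel 𝕜 H) w => d.meas w Set.univ = 1) D S) :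
    IsProbabilityMeasure (E.loebMeasure D S) := by
  obtain ⟨U, hU, hU1⟩ := exists_internalSet_univ h1
  exact ⟨by rw [← hU, loebMeasure_internalSet hE ⟨U, hU⟩, hU1]⟩

end NonstandardExtension

/-! ### Integration of standard parts of internal functions -/

/-- Approximation of a nonnegative number from above by a sum of steps of height `δ`. -/
theorem sum_range_step_bounds {y δ : ℝ} (hδ : 0 < δ) (K : ℕ) (hy : 0 ≤ y) :
    min y (K * δ) ≤ ∑ k ∈ Finset.range K, (if k * δ < y then δ else 0) ∧
      ∑ k ∈ Finset.range K, (if k * δ < y then δ else 0) ≤ min (y + δ) (K * δ) := by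
  induction K with
  | zero => simp [hy, add_nonneg hy hδ.le]
  | succ K ih =>
    rw [Finset.sum_range_succ]
    push_cast
    obtain ⟨h1, h2⟩ := ih
    rw [le_min_iff] at h2
    split_ifs with h
    · rw [min_eq_right h.le] at h1
      exact ⟨(min_le_right _ _).trans (by linarith), le_min (by linarith) (by linarith)⟩
    · rw [min_eq_left (not_lt.1 h)] at h1
      exact ⟨(min_le_left _ _).trans (by linarith), le_min (by linarith) (by linarith)⟩

namespace NonstandardExtension

open FinModel

variable {E : NonstandardExtension.{u, v}} {𝕜 : Type} {H X : Type u} [RCLike 𝕜]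
  [NormedAddCommGroup H] [InnerProductSpace 𝕜 H]
  {D : E.star (FinModel 𝕜 H)} {S : E.star (FinScale H)}
  {a : E.star X} {d : X → FinModel 𝕜 H} {w : X → FinScale H}

variable (D S) in
/-- The standard part `Ω_L → [-∞, ∞]` of the internal function `f ↦ *G(a, f)` on `Ω̃`. -/
noncomputable def loebFun (a : E.star X) (G : X → H → ℝ) (f : E.LoebSpace D S) : EReal :=
  E.stE (E.map (fun z : X × H => ULift.up.{u} (G z.1 z.2)) (E.pair a f.val))

theorem tendsto_loebFun (G : X → H → ℝ) (f : E.LoebSpace D S) :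
    Tendsto (fun z : X × H => (G z.1 z.2 : EReal)) (E.ult (E.pair a f.val))
      (𝓝 (E.loebFun D S a G f)) :=
  tendsto_stE (fun z : X × H => G z.1 z.2) _

theorem tendsto_toENNReal_loebFun (G : X → H → ℝ) (f : E.LoebSpace D S) :
    Tendsto (fun z : X × H => ENNReal.ofReal (G z.1 z.2)) (E.ult (E.pair a f.val))
      (𝓝 (E.loebFun D S a G f).toENNReal) :=
  ((EReal.continuous_toENNReal.tendsto _).comp (tendsto_loebFun G f)).congr fun z => by simp

theorem measurable_loebFun (G : X → H → ℝ) : Measurable (E.loebFun D S a G) := by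
  refine measurable_of_Ioi fun c => ?_
  have h : E.loebFun D S a G ⁻¹' Set.Ioi c = ⋃ (t : ℚ) (_ : c < ((t : ℝ) : EReal)),
      E.internalSet D S (E.map (fun q => {f | (t : ℝ) < G q f}) a) := by
    ext f
    simp only [Set.mem_preimage, Set.mem_Ioi, Set.mem_iUnion, mem_internalSet_map, exists_prop]
    constructor
    · intro hc
      obtain ⟨t, h1, h2⟩ := EReal.exists_rat_btwn_of_lt hc
      refine ⟨t, h1, ((tendsto_loebFun G f).eventually (lt_mem_nhds h2)).mono fun z hz => ?_⟩
      exact EReal.coe_lt_coe_iff.1 hz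
    · rintro ⟨t, h1, h2⟩
      refine h1.trans_le (ge_of_tendsto (tendsto_loebFun G f) ?_)
      exact h2.mono fun z hz => EReal.coe_le_coe_iff.2 (le_of_lt hz)
  rw [h]
  exact MeasurableSet.iUnion fun t => MeasurableSet.iUnion fun _ => measurableSet_internalSet _

section Integral

variable (hE : E.CountablySaturatedAt H)
  (h1 : E.Holds₂ (fun (d : FinModel 𝕜 H) w => d.meas w Set.univ = 1) D S)
  (hd : E.map d a = D) (hw : E.map w a = S)

include hE h1 hd hw

/-- The Loeb integral of an internal step function is a limit of finite sums, and step functions of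
height `δ` approximate both the internal integral and the integral of the standard part. -/
theorem exists_step_approximation {G : X → H → ℝ} (hG : ∀ᶠ q in E.ult a, ∀ f ∈ (d q).Ω, 0 ≤ G q f)
    {δ : ℝ} (hδ : 0 < δ) {K : ℕ} (hK : ∀ᶠ q in E.ult a, ∀ f ∈ (d q).Ω, G q f ≤ K * δ) {B : ℝ}
    (hB : Tendsto (fun q => ∑ f ∈ (d q).Ω, G q f * weight (𝕜 := 𝕜) (w q) f) (E.ult a) (𝓝 B)) :
    ∃ I : ℝ≥0∞, ENNReal.ofReal B ≤ I ∧ I ≤ ENNReal.ofReal B + ENNReal.ofReal δ ∧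
      ∫⁻ f, (E.loebFun D S a G f).toENNReal ∂(E.loebMeasure D S) ≤ I ∧
      I ≤ ∫⁻ f, (E.loebFun D S a G f).toENNReal ∂(E.loebMeasure D S) + ENNReal.ofReal δ := by
  classical
  have hprob := isProbabilityMeasure_loebMeasure hE h1
  have hU : ∃ U, E.internalSet D S U = Set.univ := (exists_internalSet_univ h1).imp fun _ h => h.1
  let v : ℕ → X → Set H := fun k q => {f | k * δ < G q f}
  let A : ℕ → Set (E.LoebSpace D S) := fun k => E.internalSet D S (E.map (v k) a)
  have hA : ∀ k f, f ∈ A k ↔ ∀ᶠ z : X × H in E.ult (E.pair a f.val), k * δ < G z.1 z.2 :=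
    fun k f => mem_internalSet_map
  -- the standard part of the internal step function
  let h : E.LoebSpace D S → ℝ≥0∞ := fun f =>
    ∑ k ∈ Finset.range K, (A k).indicator (fun _ => ENNReal.ofReal δ) f
  have hh : ∀ f, ∀ᶠ z : X × H in E.ult (E.pair a f.val), h f =
      ENNReal.ofReal (∑ k ∈ Finset.range K, if k * δ < G z.1 z.2 then δ else 0) := by
    intro f
    have hev : ∀ᶠ z : X × H in E.ult (E.pair a f.val), ∀ k ∈ Finset.range K,
        (f ∈ A k ↔ k * δ < G z.1 z.2) := by
      rw [eventually_all_finset]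
      intro k _
      by_cases hf : f ∈ A k
      · exact ((hA k f).1 hf).mono fun z hz => iff_of_true hf hz
      · exact (Ultrafilter.eventually_not.2 (mt (hA k f).2 hf)).mono fun z hz => iff_of_false hf hz
    filter_upwards [hev] with z hz
    rw [ENNReal.ofReal_sum_of_nonneg fun k _ => by split_ifs <;> simp [hδ.le]]
    refine Finset.sum_congr rfl fun k hk => ?_
    rw [Set.indicator_apply]
    simp only [hz k hk]
    split_ifs <;> simp
  have hbd : ∀ f, (E.loebFun D S a G f).toENNReal ≤ h f ∧
      h f ≤ (E.loebFun D S a G f).toENNReal + ENNReal.ofReal δ := by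
    intro f
    have hG' := (forall_loebSpace_iff S hd).2 hG f
    have hK' := (forall_loebSpace_iff S hd).2 hK f
    constructor
    · refine le_of_tendsto (tendsto_toENNReal_loebFun G f) ?_
      filter_upwards [hh f, hG', hK'] with z hz hz1 hz2
      rw [hz]
      refine ENNReal.ofReal_le_ofReal (le_trans ?_ (sum_range_step_bounds hδ K hz1).1)
      exact le_min le_rfl hz2
    · refine ge_of_tendsto ((tendsto_toENNReal_loebFun G f).add tendsto_const_nhds) ?_
      filter_upwards [hh f, hG'] with z hz hz1
      rw [hz, ← ENNReal.ofReal_add hz1 hδ.le]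
      exact ENNReal.ofReal_le_ofReal ((sum_range_step_bounds hδ K hz1).2.trans (min_le_left _ _))
  have hint : ∫⁻ f, h f ∂(E.loebMeasure D S) =
      ∑ k ∈ Finset.range K, ENNReal.ofReal δ * E.loebContent D S (E.map (v k) a) := by
    rw [lintegral_finsetSum _ fun k _ =>
      measurable_const.indicator (measurableSet_internalSet (E.map (v k) a))]
    refine Finset.sum_congr rfl fun k _ => ?_
    rw [lintegral_indicator_const (measurableSet_internalSet _), loebMeasure_internalSet hE hU]
  have hlim : Tendsto (fun q => ENNReal.ofReal (∑ f ∈ (d q).Ω,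
      (∑ k ∈ Finset.range K, if k * δ < G q f then δ else 0) * weight (𝕜 := 𝕜) (w q) f)) (E.ult a)
      (𝓝 (∫⁻ f, h f ∂(E.loebMeasure D S))) := by
    rw [hint]
    refine (tendsto_finsetSum _ fun k _ => ENNReal.Tendsto.const_mul
      (tendsto_loebContent hd hw (v k)) (Or.inr ENNReal.ofReal_ne_top)).congr fun q => ?_
    have h2 := (d q).sum_mul_meas_eq_sum_weight (w q) K δ (fun k => v k q)
    simp only [v, Set.mem_ofPred_eq] at h2
    rw [← h2, ENNReal.ofReal_sum_of_nonneg fun k _ =>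
      mul_nonneg hδ.le ((d q).meas_nonneg (w q) _)]
    exact Finset.sum_congr rfl fun k _ => (ENNReal.ofReal_mul hδ.le).symm
  have h1' : ∀ᶠ q in E.ult a, (d q).meas (w q) Set.univ = 1 := by
    rw [← hd, ← hw, holds₂_map] at h1
    exact h1
  refine ⟨∫⁻ f, h f ∂(E.loebMeasure D S), ?_, ?_, lintegral_mono fun f => (hbd f).1, ?_⟩
  · refine le_of_tendsto_of_tendsto ((ENNReal.continuous_ofReal.tendsto _).comp hB) hlim ?_
    filter_upwards [hG, hK] with q hq1 hq2
    refine ENNReal.ofReal_le_ofReal (Finset.sum_le_sum fun f hf => ?_)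
    refine mul_le_mul_of_nonneg_right ?_ (weight_nonneg _ _)
    exact (le_min le_rfl (hq2 f hf)).trans (sum_range_step_bounds hδ K (hq1 f hf)).1
  · refine le_of_tendsto_of_tendsto hlim
      (((ENNReal.continuous_ofReal.tendsto _).comp hB).add tendsto_const_nhds) ?_
    filter_upwards [hG, h1'] with q hq1 hq2
    simp only [Function.comp_apply]
    rw [← ENNReal.ofReal_add (Finset.sum_nonneg fun f hf => mul_nonneg (hq1 f hf)
      (weight_nonneg _ _)) hδ.le]
    refine ENNReal.ofReal_le_ofReal ?_
    calc _ ≤ ∑ f ∈ (d q).Ω, (G q f + δ) * weight (𝕜 := 𝕜) (w q) f :=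
          Finset.sum_le_sum fun f hf => mul_le_mul_of_nonneg_right
            ((sum_range_step_bounds hδ K (hq1 f hf)).2.trans (min_le_left _ _)) (weight_nonneg _ _)
      _ = _ := by
          simp only [add_mul]
          rw [Finset.sum_add_distrib, ← Finset.mul_sum, sum_weight, hq2, mul_one]
  · calc _ ≤ ∫⁻ f, ((E.loebFun D S a G f).toENNReal + ENNReal.ofReal δ) ∂(E.loebMeasure D S) :=
          lintegral_mono fun f => (hbd f).2
      _ = _ := by
          rw [lintegral_add_right _ measurable_const, lintegral_const, measure_univ, mul_one]

/-- For an internal function with standard bounds, the Loeb integral of the standard part is the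
standard part of the internal integral. -/
theorem lintegral_loebFun_of_bounded {G : X → H → ℝ}
    (hG : ∀ᶠ q in E.ult a, ∀ f ∈ (d q).Ω, 0 ≤ G q f)
    {C : ℝ} (hC : ∀ᶠ q in E.ult a, ∀ f ∈ (d q).Ω, G q f ≤ C) {B : ℝ}
    (hB : Tendsto (fun q => ∑ f ∈ (d q).Ω, G q f * weight (𝕜 := 𝕜) (w q) f) (E.ult a) (𝓝 B)) :
    ∫⁻ f, (E.loebFun D S a G f).toENNReal ∂(E.loebMeasure D S) = ENNReal.ofReal B := by
  have key : ∀ δ : NNReal, 0 < δ → ∃ I : ℝ≥0∞, ENNReal.ofReal B ≤ I ∧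
      I ≤ ENNReal.ofReal B + δ ∧
      ∫⁻ f, (E.loebFun D S a G f).toENNReal ∂(E.loebMeasure D S) ≤ I ∧
      I ≤ ∫⁻ f, (E.loebFun D S a G f).toENNReal ∂(E.loebMeasure D S) + δ := by
    intro δ hδ
    obtain ⟨K, hK⟩ := exists_nat_ge (C / δ)
    rw [div_le_iff₀ (by exact_mod_cast hδ)] at hK
    have := exists_step_approximation hE h1 hd hw hG (δ := δ) (by exact_mod_cast hδ) (K := K)
      (hC.mono fun q hq f hf => (hq f hf).trans hK) hB
    simpa using this
  refine le_antisymm (ENNReal.le_of_forall_pos_le_add fun δ hδ _ => ?_)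
    (ENNReal.le_of_forall_pos_le_add fun δ hδ _ => ?_)
  · obtain ⟨I, -, h2, h3, -⟩ := key δ hδ
    exact h3.trans h2
  · obtain ⟨I, h2, -, -, h3⟩ := key δ hδ
    exact h2.trans h3

/-- For a nonnegative internal function, the Loeb integral of the standard part is at most the
standard part of the internal integral. -/
theorem lintegral_loebFun_le {G : X → H → ℝ} (hG : ∀ᶠ q in E.ult a, ∀ f ∈ (d q).Ω, 0 ≤ G q f)
    {B : ℝ} (hB : ∀ᶠ q in E.ult a, ∑ f ∈ (d q).Ω, G q f * weight (𝕜 := 𝕜) (w q) f ≤ B) :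
    ∫⁻ f, (E.loebFun D S a G f).toENNReal ∂(E.loebMeasure D S) ≤ ENNReal.ofReal B := by
  -- truncation at the height `n`, followed by monotone convergence
  let G' : ℕ → X → H → ℝ := fun n q f => min (G q f) n
  have hG' : ∀ n, ∀ᶠ q in E.ult a, ∀ f ∈ (d q).Ω, 0 ≤ G' n q f := fun n =>
    hG.mono fun q hq f hf => le_min (hq f hf) n.cast_nonneg
  have hst : ∀ n f, (E.loebFun D S a (G' n) f).toENNReal =
      (E.loebFun D S a G f).toENNReal ⊓ n := by
    intro n f
    refine tendsto_nhds_unique (tendsto_toENNReal_loebFun (G' n) f)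
      (((tendsto_toENNReal_loebFun G f).min tendsto_const_nhds).congr fun z => ?_)
    rw [← ENNReal.ofReal_natCast, ENNReal.ofReal_min]
  have hle : ∀ n, ∫⁻ f, (E.loebFun D S a (G' n) f).toENNReal ∂(E.loebMeasure D S) ≤
      ENNReal.ofReal B := by
    intro n
    have hB' : ∀ᶠ q in E.ult a, ∑ f ∈ (d q).Ω, G' n q f * weight (𝕜 := 𝕜) (w q) f ≤ B := by
      filter_upwards [hB] with q hq
      exact (Finset.sum_le_sum fun f _ => mul_le_mul_of_nonneg_right (min_le_left _ _)
        (weight_nonneg _ _)).trans hq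
    obtain ⟨B', hB''⟩ := exists_tendsto_of_eventually_norm_le (U := E.ult a) (C := B)
      (g := fun q => ∑ f ∈ (d q).Ω, G' n q f * weight (𝕜 := 𝕜) (w q) f) (by
        filter_upwards [hB', hG' n] with q hq hq'
        rwa [Real.norm_of_nonneg (Finset.sum_nonneg fun f hf => mul_nonneg (hq' f hf)
          (weight_nonneg _ _))])
    rw [lintegral_loebFun_of_bounded hE h1 hd hw (hG' n) (C := n)
      (Eventually.of_forall fun q f _ => min_le_right _ _) hB'']
    exact ENNReal.ofReal_le_ofReal (le_of_tendsto hB'' hB')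
  have hsup : ∀ f, (E.loebFun D S a G f).toENNReal =
      ⨆ n : ℕ, (E.loebFun D S a (G' n) f).toENNReal := by
    intro f
    simp only [hst]
    rw [← inf_iSup_eq, ENNReal.iSup_natCast, inf_top_eq]
  simp only [hsup]
  rw [lintegral_iSup fun n => (measurable_loebFun (G' n)).ereal_toENNReal]
  · exact iSup_le hle
  · intro m n hmn f
    simp only [hst]
    exact inf_le_inf_left _ (by exact_mod_cast hmn)

end Integral

end NonstandardExtension

/-! ### Multiplication operators -/

section MulOperator

variable {𝕜 : Type} [RCLike 𝕜] {α : Type*} [MeasurableSpace α] {μ : Measure α} {m : α → ℝ}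

theorem mem_mulOperator_domain {g : Lp 𝕜 2 μ} :
    g ∈ (mulOperator 𝕜 μ m).domain ↔ MemLp (fun t => ((m t : ℝ) : 𝕜) * g t) 2 μ :=
  Iff.rfl

theorem coeFn_mulOperator (g : (mulOperator 𝕜 μ m).domain) :
    (mulOperator 𝕜 μ m g : α → 𝕜) =ᵐ[μ] fun t => ((m t : ℝ) : 𝕜) * (g : Lp 𝕜 2 μ) t :=
  MemLp.coeFn_toLp g.2

theorem mem_graph_mulOperator_of_ae_eq {g h : Lp 𝕜 2 μ}
    (hgh : h =ᵐ[μ] fun t => ((m t : ℝ) : 𝕜) * g t) : (g, h) ∈ (mulOperator 𝕜 μ m).graph := by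
  have hg : g ∈ (mulOperator 𝕜 μ m).domain := (memLp_congr_ae hgh).1 (Lp.memLp h)
  rw [LinearPMap.mem_graph_iff]
  exact ⟨⟨g, hg⟩, rfl, Lp.ext ((coeFn_mulOperator ⟨g, hg⟩).trans hgh.symm)⟩

/-- An adjoint pair for the multiplication operator satisfies `z = m y`. It is tested against the
truncations of `z - m y` to the sets `{|m| ≤ n}`, which belong to the domain. -/
theorem ae_eq_mul_of_inner_eq (hm : Measurable m) {y z : Lp 𝕜 2 μ}
    (h : ∀ x : (mulOperator 𝕜 μ m).domain, ⟪z, (x : Lp 𝕜 2 μ)⟫_𝕜 = ⟪y, mulOperator 𝕜 μ m x⟫_𝕜) :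
    z =ᵐ[μ] fun t => ((m t : ℝ) : 𝕜) * y t := by
  have key : ∀ n : ℕ, ∀ᵐ t ∂μ, |m t| ≤ n → z t = ((m t : ℝ) : 𝕜) * y t := by
    intro n
    let s : Set α := {t | |m t| ≤ n}
    have hs : MeasurableSet s := measurableSet_le hm.abs measurable_const
    have hmul : ∀ g : α → 𝕜, MemLp g 2 μ →
        MemLp (s.indicator fun t => ((m t : ℝ) : 𝕜) * g t) 2 μ := by
      intro g hg
      refine (hg.norm.const_mul (n : ℝ)).mono
        (((RCLike.measurable_ofReal.comp hm).aestronglyMeasurable.mul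
          hg.aestronglyMeasurable).indicator hs) (Eventually.of_forall fun t => ?_)
      by_cases ht : t ∈ s
      · rw [Set.indicator_of_mem ht, norm_mul, norm_mul, norm_norm, RCLike.norm_ofReal,
          Real.norm_natCast]
        exact mul_le_mul_of_nonneg_right ht (norm_nonneg _)
      · rw [Set.indicator_of_notMem ht, norm_zero]
        exact norm_nonneg _
    have hx : MemLp (s.indicator fun t => z t - ((m t : ℝ) : 𝕜) * y t) 2 μ := by
      have := ((Lp.memLp z).indicator hs).sub (hmul _ (Lp.memLp y))
      rwa [← Set.indicator_sub'] at this
    have hmx : hx.toLp ∈ (mulOperator 𝕜 μ m).domain := by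
      rw [mem_mulOperator_domain]
      refine (memLp_congr_ae ?_).1 (hmul _ hx)
      filter_upwards [hx.coeFn_toLp] with t ht
      rw [ht]
      by_cases hts : t ∈ s <;> simp [hts]
    -- with `x` the truncation of `z - m y`, the hypothesis says `⟪x, x⟫ = ⟪z, x⟫ - ⟪y, m x⟫ = 0`
    have h0 : ⟪hx.toLp, hx.toLp⟫_𝕜 = 0 := by
      rw [← sub_eq_zero.2 (h ⟨_, hmx⟩), L2.inner_def, L2.inner_def, L2.inner_def,
        ← integral_sub (L2.integrable_inner _ _) (L2.integrable_inner _ _)]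
      refine integral_congr_ae ?_
      filter_upwards [hx.coeFn_toLp, coeFn_mulOperator ⟨_, hmx⟩] with t h1 h2
      rw [h2]
      simp only [h1]
      by_cases hts : t ∈ s
      · simp only [Set.indicator_of_mem hts, RCLike.inner_apply, map_sub, map_mul,
          RCLike.conj_ofReal]
        ring
      · simp [Set.indicator_of_notMem hts]
    have h1 := hx.coeFn_toLp
    rw [inner_self_eq_zero.1 h0] at h1
    filter_upwards [h1, Lp.coeFn_zero 𝕜 2 μ] with t ht ht0 hts
    rw [ht0, Set.indicator_of_mem (show t ∈ s from hts)] at ht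
    exact sub_eq_zero.1 ht.symm
  filter_upwards [ae_all_iff.2 key] with t ht
  obtain ⟨n, hn⟩ := exists_nat_ge |m t|
  exact ht n hn

theorem dense_domain_mulOperator (hm : Measurable m) :
    Dense ((mulOperator 𝕜 μ m).domain : Set (Lp 𝕜 2 μ)) := by
  rw [Submodule.dense_iff_topologicalClosure_eq_top, Submodule.topologicalClosure_eq_top_iff,
    Submodule.eq_bot_iff]
  intro y hy
  rw [Submodule.mem_orthogonal'] at hy
  -- a vector `y` orthogonal to the domain forms an adjoint pair with `0`, so that `y = m 0`
  have h := ae_eq_mul_of_inner_eq (y := (0 : Lp 𝕜 2 μ)) (z := y) hm fun x => by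
    rw [hy _ x.2, inner_zero_left]
  refine Lp.ext (h.trans ?_)
  filter_upwards [Lp.coeFn_zero 𝕜 2 μ] with t ht
  rw [ht]
  simp

theorem isSelfAdjoint_mulOperator (hm : Measurable m) : IsSelfAdjoint (mulOperator 𝕜 μ m) := by
  have hdense := dense_domain_mulOperator (𝕜 := 𝕜) (μ := μ) hm
  rw [LinearPMap.isSelfAdjoint_def]
  refine le_antisymm ?_ (LinearPMap.IsFormalAdjoint.le_adjoint hdense fun x y => ?_)
  · have key : ∀ y : (mulOperator 𝕜 μ m).adjoint.domain,
        ((mulOperator 𝕜 μ m).adjoint y : α → 𝕜) =ᵐ[μ]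
          fun t => ((m t : ℝ) : 𝕜) * (y : Lp 𝕜 2 μ) t := fun y =>
      ae_eq_mul_of_inner_eq hm fun x => LinearPMap.adjoint_isFormalAdjoint hdense y x
    refine ⟨fun y hy => (memLp_congr_ae (key ⟨y, hy⟩)).1 (Lp.memLp _), fun y z hyz => ?_⟩
    refine Lp.ext ((key y).trans ?_)
    rw [hyz]
    exact (coeFn_mulOperator z).symm
  · rw [L2.inner_def, L2.inner_def]
    refine integral_congr_ae ?_
    filter_upwards [coeFn_mulOperator x, coeFn_mulOperator y] with t h1 h2
    rw [h1, h2]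
    simp only [RCLike.inner_apply, map_mul, RCLike.conj_ofReal]
    ring

end MulOperator

namespace NonstandardExtension

open FinModel

variable {E : NonstandardExtension.{u, v}} {𝕜 : Type} {H X : Type u} [RCLike 𝕜]
  [NormedAddCommGroup H] [InnerProductSpace 𝕜 H]
  {D : E.star (FinModel 𝕜 H)} {S : E.star (FinScale H)}
  {a : E.star X} {d : X → FinModel 𝕜 H} {w : X → FinScale H}

/-! ### Consequences of the axioms of a compatible standard-biased scale -/

theorem IsCompatible.holds_meas_univ (hS : E.IsStandardBiased 𝕜 S) (hDS : E.IsCompatible D S) :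
    E.Holds₂ (fun (d : FinModel 𝕜 H) w => d.meas w Set.univ = 1) D S := by
  have h1 := hDS.e_mem
  have h2 := hS.sum_eq_one
  obtain ⟨X, a, d, w, -, -, rfl, rfl, -, -⟩ := exists_param D S D D
  rw [holds₂_map] at h1 ⊢
  have h2' : ∀ᶠ q in E.ult a, ∑ j ∈ Finset.Icc 1 (w q).N, (w q).c j * ‖(w q).e j‖ ^ 2 = 1 :=
    holds_map_iff.1 h2
  filter_upwards [h1, h2'] with q hq1 hq2
  rw [meas_univ _ _ hq1, hq2]

theorem IsCompatible.eventually_weight_pos (hDS : E.IsCompatible D S) (hd : E.map d a = D)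
    (hw : E.map w a = S) :
    ∀ᶠ q in E.ult a, ∀ f ∈ (d q).Ω, 0 < weight (𝕜 := 𝕜) (w q) f := by
  have h := hDS.detects
  rw [← hd, ← hw, holds₂_map] at h
  exact h.mono fun q hq f hf => weight_pos _ (hq f hf)

/-- Underspill for the tails of the scale: the least index at which the tail drops below `ε` is a
standard number, since otherwise its predecessor would be an infinite index with a tail that is
not infinitesimal. -/
theorem IsStandardBiased.exists_tail_lt (hS : E.IsStandardBiased 𝕜 S) {ε : ℝ} (hε : 0 < ε) :
    ∃ J : ℕ, E.Holds (fun w => J ≤ w.N ∧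
      ∑ j ∈ Finset.Icc 1 w.N with J < j, w.c j * ‖w.e j‖ ^ 2 < ε) S := by
  classical
  let t : FinScale H → ℕ → ℝ := fun w k => ∑ j ∈ Finset.Icc 1 w.N with k < j, w.c j * ‖w.e j‖ ^ 2
  have hex : ∀ w : FinScale H, ∃ k, t w k < ε := fun w => ⟨w.N, by
    have : ({j ∈ Finset.Icc 1 w.N | w.N < j} : Finset ℕ) = ∅ := by
      ext j
      simp
    simp only [t, this, Finset.sum_empty, hε]⟩
  have hanti : ∀ (w : FinScale H) {k l : ℕ}, k ≤ l → t w l ≤ t w k := by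
    intro w k l hkl
    refine Finset.sum_le_sum_of_subset_of_nonneg (fun j hj => ?_) fun j hj _ => ?_
    · rw [Finset.mem_filter] at hj ⊢
      exact ⟨hj.1, hkl.trans_lt hj.2⟩
    · exact mul_nonneg (w.c_nonneg j (Finset.mem_filter.1 hj).1) (by positivity)
  let g : FinScale H → ℕ := fun w => Nat.find (hex w)
  by_cases hg : ∃ n, ∀ᶠ w in E.ult S, g w ≤ n
  · obtain ⟨n, hn⟩ := hg
    have hN : ∀ᶠ w : FinScale H in E.ult S, n < w.N := holds_map_iff.1 (hS.N_infinite n)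
    refine ⟨n, ?_⟩
    filter_upwards [hn, hN] with w hw1 hw2
    exact ⟨hw2.le, (hanti w hw1).trans_lt (Nat.find_spec (hex w))⟩
  · exfalso
    rw [not_exists] at hg
    have hg' : ∀ n, ∀ᶠ w in E.ult S, n < g w := fun n =>
      (Ultrafilter.eventually_not.2 (hg n)).mono fun w hw => not_le.1 hw
    have hinf : E.IsInfinite (E.map (fun w => ULift.up.{u} (g w - 1)) S) := by
      intro n
      refine holds_map_iff.2 ?_
      exact (hg' (n + 1)).mono fun w hw => by
        change n < g w - 1
        omega
    have ht := hS.tail _ hinf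
    have hmap := map₂_map (fun (k : ULift.{u} ℕ) (w : FinScale H) => ULift.up.{u}
      (∑ j ∈ Finset.Icc 1 w.N with k.down < j, w.c j * ‖w.e j‖ ^ 2))
      (fun w => ULift.up (g w - 1)) (fun w => w) S
    rw [E.map_id] at hmap
    rw [hmap] at ht
    have ht' : Tendsto (fun w => t w (g w - 1)) (E.ult S) (𝓝 0) := isSt_map_up.1 ht
    obtain ⟨w, hw1, hw2⟩ := ((ht'.eventually (gt_mem_nhds hε)).and (hg' 0)).exists
    exact Nat.find_min (hex w) (show g w - 1 < g w by omega) hw1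

/-- A standard bound for `c_j ‖Ã e_j‖²`, written as a sum over the eigenvectors. -/
theorem IsCompatible.exists_bound_eigenvalue (hS : E.IsStandardBiased 𝕜 S)
    (hDS : E.IsCompatible D S) {j : ℕ} (hj : 1 ≤ j) :
    ∃ R : ℝ, E.Holds₂ (fun (d : FinModel 𝕜 H) w =>
      w.c j * ∑ f ∈ d.Ω, d.eigenvalue f ^ 2 * ‖⟪f, w.e j⟫_𝕜‖ ^ 2 ≤ R) D S := by
  obtain ⟨y, hy, y₀, hy₀⟩ := hDS.image_nearstandard j hj
  obtain ⟨⟨c₀⟩, hc₀⟩ := hS.c_nearstandard j hj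
  obtain ⟨X, a, d, w, y, -, rfl, rfl, rfl, -⟩ := exists_param D S y y
  rw [← E.map_comp] at hy hc₀
  rw [holds₃_map] at hy
  rw [isSt_map] at hy₀
  rw [isSt_map_up (g := fun q => (w q).c j)] at hc₀
  refine ⟨c₀ * ‖y₀‖ ^ 2 + 1, ?_⟩
  rw [holds₂_map]
  have hlim := hc₀.mul (hy₀.norm.pow 2)
  filter_upwards [hy, hlim.eventually (gt_mem_nhds (lt_add_one _))] with q hq1 hq2
  rw [hq1.sum_eigenvalue_sq_mul]
  exact hq2.le

theorem loebMultiplier_eq (hd : E.map d a = D) (f : E.LoebSpace D S) :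
    E.loebMultiplier D S f = E.loebFun D S a (fun q f => (d q).eigenvalue f) f := by
  change E.stE (E.map₂ (fun d f => ULift.up (d.eigenvalue f)) D f.val) = _
  subst hd
  have h := map₂_map (E := E) (fun (d : FinModel 𝕜 H) f => ULift.up.{u} (d.eigenvalue f))
    (fun z : X × H => d z.1) Prod.snd (E.pair a f.val)
  rw [← map_eq_fst, E.map_snd_pair] at h
  rw [h]
  rfl

theorem measurable_loebMultiplier : Measurable (E.loebMultiplier D S) := by
  have h : E.loebMultiplier D S = E.loebFun D S D (fun d f => d.eigenvalue f) :=
    funext fun f => loebMultiplier_eq (E.map_id _ D) f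
  rw [h]
  exact measurable_loebFun _

/-- The eigenvalues are finite almost everywhere, by Chebyshev's inequality for the vectors
`e_j`, `j ≤ J`, of the scale, whose images are nearstandard, and the smallness of the tail. -/
theorem ae_loebMultiplier_ne (hE : E.CountablySaturatedAt H) (hS : E.IsStandardBiased 𝕜 S)
    (hDS : E.IsCompatible D S) :
    ∀ᵐ f ∂(E.loebMeasure D S), E.loebMultiplier D S f ≠ ⊥ ∧ E.loebMultiplier D S f ≠ ⊤ := by
  have h1 := hDS.holds_meas_univ hS
  have hU : ∃ U, E.internalSet D S U = Set.univ := (exists_internalSet_univ h1).imp fun _ h => h.1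
  obtain ⟨X, a, d, w, -, -, hd, hw, -, -⟩ := exists_param D S D D
  rw [ae_iff, ← nonpos_iff_eq_zero]
  refine ENNReal.le_of_forall_pos_le_add fun ε hε _ => ?_
  rw [zero_add]
  obtain ⟨J, hJ⟩ := hS.exists_tail_lt (ε := ε / 2) (by positivity)
  rw [← hw] at hJ
  replace hJ : ∀ᶠ q in E.ult a, J ≤ (w q).N ∧
      ∑ j ∈ Finset.Icc 1 (w q).N with J < j, (w q).c j * ‖(w q).e j‖ ^ 2 < ε / 2 :=
    holds_map_iff.1 hJ
  choose! R hR using fun j hj => hDS.exists_bound_eigenvalue hS (j := j) hj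
  have hR' : ∀ᶠ q in E.ult a, ∀ j ∈ Finset.Icc 1 J,
      (w q).c j * ∑ f ∈ (d q).Ω, (d q).eigenvalue f ^ 2 * ‖⟪f, (w q).e j⟫_𝕜‖ ^ 2 ≤ R j := by
    rw [eventually_all_finset]
    intro j hj
    have := hR j (Finset.mem_Icc.1 hj).1
    rwa [← hd, ← hw, holds₂_map] at this
  obtain ⟨n, hn0, hn⟩ : ∃ n : ℕ, 0 < n ∧ (∑ j ∈ Finset.Icc 1 J, R j) / n ^ 2 ≤ ε / 2 := by
    have hlim : Tendsto (fun n : ℕ => (∑ j ∈ Finset.Icc 1 J, R j) / (n : ℝ) ^ 2) atTop (𝓝 0) :=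
      tendsto_const_nhds.div_atTop
        ((tendsto_pow_atTop two_ne_zero).comp tendsto_natCast_atTop_atTop)
    obtain ⟨n, hn1, hn2⟩ := ((eventually_gt_atTop 0).and
      (hlim.eventually (gt_mem_nhds (show (0 : ℝ) < ε / 2 by positivity)))).exists
    exact ⟨n, hn1, hn2.le⟩
  let V : E.star (Set H) := E.map (fun q => {f | (n : ℝ) < |(d q).eigenvalue f|}) a
  have hsub : {f | ¬ (E.loebMultiplier D S f ≠ ⊥ ∧ E.loebMultiplier D S f ≠ ⊤)} ⊆
      E.internalSet D S V := by
    intro f hf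
    by_contra hfV
    rw [mem_internalSet_map, ← Ultrafilter.eventually_not] at hfV
    refine hf ?_
    have hlim := tendsto_loebFun (a := a) (fun q f => (d q).eigenvalue f) f
    rw [← loebMultiplier_eq hd] at hlim
    constructor
    · refine ((EReal.bot_lt_coe (-(n : ℝ))).trans_le (ge_of_tendsto hlim ?_)).ne'
      filter_upwards [hfV] with z hz
      exact EReal.coe_le_coe_iff.2 (abs_le.1 (not_lt.1 hz)).1
    · refine ((le_of_tendsto hlim ?_).trans_lt (EReal.coe_lt_top (n : ℝ))).ne
      filter_upwards [hfV] with z hz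
      exact EReal.coe_le_coe_iff.2 (abs_le.1 (not_lt.1 hz)).2
  refine (measure_mono hsub).trans ?_
  rw [loebMeasure_internalSet hE hU]
  refine le_of_tendsto (tendsto_loebContent hd hw _) ?_
  filter_upwards [hJ, hR'] with q hq1 hq2
  rw [← ENNReal.ofReal_coe_nnreal]
  refine ENNReal.ofReal_le_ofReal ?_
  refine (meas_large_eigenvalue_le (d q) (w q) (by exact_mod_cast hn0) hq1.1).trans ?_
  calc _ ≤ (∑ j ∈ Finset.Icc 1 J, R j) / (n : ℝ) ^ 2 + ε / 2 := by
        gcongr with j hj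
        · exact hq2 j hj
        · exact hq1.2.le
    _ ≤ ε := by linarith

/-! ### The transform -/

theorem internalU_eq (hd : E.map d a = D) (hw : E.map w a = S) (x : H) (f : E.LoebSpace D S) :
    E.internalU D S x f = E.map (fun z : X × H =>
      ULift.up.{u} ((d z.1).transform (w z.1) x z.2)) (E.pair a f.val) := by
  change E.map₃ _ D S f.val = _
  subst hd hw
  have h := map₃_map (E := E) (fun (d : FinModel 𝕜 H) w f => ULift.up.{u} (d.transform w x f))
    (fun z : X × H => d z.1) (fun z : X × H => w z.1) Prod.snd (E.pair a f.val)
  rw [← map_eq_fst, ← map_eq_fst, E.map_snd_pair] at h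
  exact h

theorem eLpNorm_two_sq {α : Type*} [MeasurableSpace α] (μ : Measure α) (g : α → 𝕜) :
    eLpNorm g 2 μ ^ 2 = ∫⁻ t, ‖g t‖ₑ ^ 2 ∂μ := by
  have h := eLpNorm_nnreal_pow_eq_lintegral (p := 2) (f := g) (μ := μ) two_ne_zero
  simpa using h

section Transform

variable (hE : E.CountablySaturatedAt H) (hS : E.IsStandardBiased 𝕜 S) (hDS : E.IsCompatible D S)
  (hd : E.map d a = D) (hw : E.map w a = S)

include hE hS hDS hd hw

/-- Bessel's inequality for the transform. -/
theorem lintegral_norm_transform_sq_le {x : X → H} {C : ℝ}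
    (hx : ∀ᶠ q in E.ult a, ‖x q‖ ^ 2 ≤ C) :
    ∫⁻ f, (E.loebFun D S a (fun q f => ‖(d q).transform (w q) (x q) f‖ ^ 2) f).toENNReal
      ∂(E.loebMeasure D S) ≤ ENNReal.ofReal C := by
  refine lintegral_loebFun_le hE (hDS.holds_meas_univ hS) hd hw
    (Eventually.of_forall fun q f _ => by positivity) ?_
  filter_upwards [hx, hDS.eventually_weight_pos hd hw] with q hq1 hq2
  exact (sum_norm_transform_sq_le _ _ _ hq2).trans hq1

/-- The transform of an infinitesimal vector is infinitesimal almost everywhere. -/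
theorem ae_tendsto_transform_zero {x : X → H} (hx : Tendsto x (E.ult a) (𝓝 0)) :
    ∀ᵐ f ∂(E.loebMeasure D S), Tendsto (fun z : X × H => (d z.1).transform (w z.1) (x z.1) z.2)
      (E.ult (E.pair a f.val)) (𝓝 0) := by
  have h0 : ∫⁻ f, (E.loebFun D S a (fun q f => ‖(d q).transform (w q) (x q) f‖ ^ 2) f).toENNReal
      ∂(E.loebMeasure D S) = 0 := by
    rw [← nonpos_iff_eq_zero]
    refine ENNReal.le_of_forall_pos_le_add fun ε hε _ => ?_
    rw [zero_add, ← ENNReal.ofReal_coe_nnreal]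
    refine lintegral_norm_transform_sq_le hE hS hDS hd hw ?_
    have hlim : Tendsto (fun q => ‖x q‖ ^ 2) (E.ult a) (𝓝 0) := by
      simpa using hx.norm.pow 2
    exact (hlim.eventually (gt_mem_nhds (show (0 : ℝ) < ε from hε))).mono fun q hq => hq.le
  rw [lintegral_eq_zero_iff (measurable_loebFun _).ereal_toENNReal] at h0
  filter_upwards [h0] with f hf
  have h1 := tendsto_toENNReal_loebFun (a := a)
    (fun q f => ‖(d q).transform (w q) (x q) f‖ ^ 2) f
  rw [hf] at h1
  have h2 := (ENNReal.tendsto_toReal ENNReal.zero_ne_top).comp h1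
  simp only [Function.comp_def, ENNReal.toReal_ofReal (sq_nonneg _), ENNReal.toReal_zero] at h2
  have h3 := h2.sqrt
  simp only [Real.sqrt_sq (norm_nonneg _), Real.sqrt_zero] at h3
  exact tendsto_zero_iff_norm_tendsto_zero.2 h3

/-- The transform of a standard vector is finite almost everywhere, as its square is integrable. -/
theorem ae_tendsto_transform_const (x : H) : ∀ᵐ f ∂(E.loebMeasure D S),
    Tendsto (fun z : X × H => (d z.1).transform (w z.1) x z.2) (E.ult (E.pair a f.val))
      (𝓝 (E.st (E.internalU D S x f))) := by
  have h := lintegral_norm_transform_sq_le hE hS hDS hd hw (x := fun _ => x)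
    (Eventually.of_forall fun _ => le_rfl)
  filter_upwards [ae_lt_top (measurable_loebFun _).ereal_toENNReal
    (h.trans_lt ENNReal.ofReal_lt_top).ne] with f hf
  obtain ⟨C, hC1, hC2⟩ := ENNReal.lt_iff_exists_nnreal_btwn.1 hf
  have hC := (tendsto_toENNReal_loebFun (a := a)
    (fun q f => ‖(d q).transform (w q) x f‖ ^ 2) f).eventually (gt_mem_nhds hC1)
  obtain ⟨y, hy⟩ := exists_tendsto_of_eventually_norm_le (U := E.ult (E.pair a f.val))
    (g := fun z : X × H => (d z.1).transform (w z.1) x z.2) (C := Real.sqrt C) (by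
      filter_upwards [hC] with z hz
      refine Real.le_sqrt_of_sq_le ?_
      rw [← ENNReal.ofReal_coe_nnreal] at hz
      exact ((ENNReal.ofReal_lt_ofReal_iff_of_nonneg (by positivity)).1 hz).le)
  rwa [internalU_eq hd hw, st_map_up hy]

/-- The standard part of the transform of a nearstandard vector only depends on the standard part
of the vector. -/
theorem ae_tendsto_transform {x : X → H} {x₀ : H} (hx : Tendsto x (E.ult a) (𝓝 x₀)) :
    ∀ᵐ f ∂(E.loebMeasure D S), Tendsto (fun z : X × H => (d z.1).transform (w z.1) (x z.1) z.2)
      (E.ult (E.pair a f.val)) (𝓝 (E.st (E.internalU D S x₀ f))) := by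
  have hx' : Tendsto (fun q => x q - x₀) (E.ult a) (𝓝 0) := by
    simpa using hx.sub_const x₀
  filter_upwards [ae_tendsto_transform_zero hE hS hDS hd hw hx',
    ae_tendsto_transform_const hE hS hDS hd hw x₀] with f h1 h2
  simpa [transform_sub] using h1.add h2

/-- The `L₂` norm of `U_L x₀` can be computed from any internal vector infinitely close to `x₀`. -/
theorem lintegral_enorm_st_sq {x : X → H} {x₀ : H} (hx : Tendsto x (E.ult a) (𝓝 x₀)) :
    ∫⁻ f, ‖E.st (E.internalU D S x₀ f)‖ₑ ^ 2 ∂(E.loebMeasure D S) =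
      ∫⁻ f, (E.loebFun D S a (fun q f => ‖(d q).transform (w q) (x q) f‖ ^ 2) f).toENNReal
        ∂(E.loebMeasure D S) := by
  refine lintegral_congr_ae ?_
  filter_upwards [ae_tendsto_transform hE hS hDS hd hw hx] with f hf
  refine tendsto_nhds_unique ?_ (tendsto_toENNReal_loebFun _ f)
  refine ((ENNReal.continuous_pow 2).tendsto _ |>.comp hf.enorm).congr fun z => ?_
  rw [Function.comp_apply, ← ofReal_norm, ENNReal.ofReal_pow (norm_nonneg _)]

end Transform

variable (D S) in
/-- The vector `x` is the standard part of a point of `H̃` with a transform that is bounded by a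
standard number. -/
def HasBoundedLift (x : H) : Prop :=
  ∃ y : E.star H, E.IsSt y x ∧ ∃ C : ℝ, E.Holds₃ (fun (d : FinModel 𝕜 H) w y =>
    y ∈ d.V ∧ ∀ f ∈ d.Ω, ‖d.transform w y f‖ ≤ C) D S y

theorem HasBoundedLift.zero : HasBoundedLift D S (0 : H) := by
  obtain ⟨X, a, d, w, -, -, rfl, rfl, -, -⟩ := exists_param D S D D
  refine ⟨E.map (fun _ => 0) a, isSt_map.2 tendsto_const_nhds, 0, ?_⟩
  rw [holds₃_map]
  exact Eventually.of_forall fun q => ⟨zero_mem _, fun f _ => by simp [transform]⟩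

theorem HasBoundedLift.add {x x' : H} (hx : HasBoundedLift D S x) (hx' : HasBoundedLift D S x') :
    HasBoundedLift D S (x + x') := by
  obtain ⟨y, h1, C, h2⟩ := hx
  obtain ⟨y', h1', C', h2'⟩ := hx'
  obtain ⟨X, a, d, w, y, y', rfl, rfl, rfl, rfl⟩ := exists_param D S y y'
  rw [isSt_map] at h1 h1'
  rw [holds₃_map] at h2 h2'
  refine ⟨E.map (fun q => y q + y' q) a, isSt_map.2 (h1.add h1'), C + C', ?_⟩
  rw [holds₃_map]
  filter_upwards [h2, h2'] with q hq hq'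
  refine ⟨add_mem hq.1 hq'.1, fun f hf => ?_⟩
  rw [transform_add]
  exact norm_add_le_of_le (hq.2 f hf) (hq'.2 f hf)

theorem HasBoundedLift.smul (b : 𝕜) {x : H} (hx : HasBoundedLift D S x) :
    HasBoundedLift D S (b • x) := by
  obtain ⟨y, h1, C, h2⟩ := hx
  obtain ⟨X, a, d, w, y, -, rfl, rfl, rfl, -⟩ := exists_param D S y y
  rw [isSt_map] at h1
  rw [holds₃_map] at h2
  refine ⟨E.map (fun q => b • y q) a, isSt_map.2 (h1.const_smul b), ‖b‖ * C, ?_⟩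
  rw [holds₃_map]
  filter_upwards [h2] with q hq
  refine ⟨Submodule.smul_mem _ _ hq.1, fun f hf => ?_⟩
  rw [transform_smul, norm_mul]
  exact mul_le_mul_of_nonneg_left (hq.2 f hf) (norm_nonneg _)

/-- The standard parts of the `e_j` have bounded lifts, as `c_j` is not infinitesimal. -/
theorem hasBoundedLift_of_isSt_e (hS : E.IsStandardBiased 𝕜 S) (hDS : E.IsCompatible D S)
    {x : H} {j : ℕ} (hj : 1 ≤ j) (hx : E.IsSt (E.map (fun w => w.e j) S) x) : HasBoundedLift D S x := by
  refine ⟨_, hx, ?_⟩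
  obtain ⟨⟨c₀⟩, hc₀⟩ := hS.c_nearstandard j hj
  obtain ⟨z, hz0, hz⟩ := hS.st_ne_zero j hj
  have hmem := hDS.e_mem
  have hN : ∀ᶠ w : FinScale H in E.ult S, j < w.N := holds_map_iff.1 (hS.N_infinite j)
  rw [isSt_map_up (g := fun w : FinScale H => w.c j)] at hc₀
  rw [isSt_map] at hz hx
  have hc_nonneg : 0 ≤ c₀ := ge_of_tendsto hc₀ (hN.mono fun w hw =>
    w.c_nonneg j (Finset.mem_Icc.2 ⟨hj, hw.le⟩))
  have hc_pos : 0 < c₀ := by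
    refine hc_nonneg.lt_of_ne fun h => hz0 ?_
    have h2 := (((RCLike.continuous_ofReal (K := 𝕜)).tendsto _).comp hc₀).smul hx
    rw [← h, RCLike.ofReal_zero, zero_smul] at h2
    exact tendsto_nhds_unique hz h2
  have hev : ∀ᶠ w : FinScale H in E.ult S, j < w.N ∧ c₀ / 2 < w.c j :=
    hN.and (hc₀.eventually (lt_mem_nhds (half_lt_self hc_pos)))
  obtain ⟨X, a, d, w, -, -, rfl, rfl, -, -⟩ := exists_param D S D D
  rw [ult_map, eventually_map] at hev
  rw [holds₂_map] at hmem
  refine ⟨Real.sqrt (1 / (c₀ / 2)), ?_⟩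
  rw [← E.map_comp, holds₃_map]
  filter_upwards [hev, hmem] with q hq1 hq2
  have hj' : j ∈ Finset.Icc 1 (w q).N := Finset.mem_Icc.2 ⟨hj, hq1.1.le⟩
  have hc : 0 < (w q).c j := (half_pos hc_pos).trans hq1.2
  refine ⟨hq2 j hj', fun f hf => Real.le_sqrt_of_sq_le ?_⟩
  refine ((d q).norm_transform_e_sq_le (w q) hf hj' hc).trans ?_
  exact one_div_le_one_div_of_le (half_pos hc_pos) hq1.2.le

section U

variable (hE : E.CountablySaturatedAt H) (hS : E.IsStandardBiased 𝕜 S) (hDS : E.IsCompatible D S)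

include hE hS hDS

theorem ae_nearstandard_internalU (x : H) :
    ∀ᵐ f ∂(E.loebMeasure D S), E.Nearstandard (E.internalU D S x f) := by
  obtain ⟨X, a, d, w, -, -, hd, hw, -, -⟩ := exists_param D S D D
  filter_upwards [ae_tendsto_transform_const hE hS hDS hd hw x] with f hf
  rw [internalU_eq hd hw]
  exact ⟨_, isSt_map_up.2 hf⟩

theorem aestronglyMeasurable_st_internalU (x : H) :
    AEStronglyMeasurable (fun f => E.st (E.internalU D S x f)) (E.loebMeasure D S) := by
  obtain ⟨X, a, d, w, -, -, hd, hw, -, -⟩ := exists_param D S D D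
  let g : (𝕜 → ℝ) → E.LoebSpace D S → ℝ := fun φ f =>
    (E.loebFun D S a (fun q f => φ ((d q).transform (w q) x f)) f).toReal
  have hg : ∀ φ, Measurable (g φ) := fun φ => (measurable_loebFun _).ereal_toReal
  refine (((RCLike.measurable_ofReal (𝕜 := 𝕜)).comp (hg RCLike.re)).add
    (((RCLike.measurable_ofReal (𝕜 := 𝕜)).comp (hg RCLike.im)).mul_const
      RCLike.I)).aestronglyMeasurable.congr ?_
  filter_upwards [ae_tendsto_transform_const hE hS hDS hd hw x] with f hf
  have key : ∀ φ : 𝕜 → ℝ, Continuous φ → g φ f = φ (E.st (E.internalU D S x f)) := by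
    intro φ hφ
    have h := stE_map_up ((continuous_coe_real_ereal.tendsto _).comp ((hφ.tendsto _).comp hf))
    change EReal.toReal (E.stE _) = _
    exact (congrArg EReal.toReal h).trans (EReal.toReal_coe _)
  simp only [Pi.add_apply, Function.comp_apply, key _ RCLike.continuous_re,
    key _ RCLike.continuous_im, RCLike.re_add_im]

theorem lintegral_enorm_st_sq_le (x : H) :
    ∫⁻ f, ‖E.st (E.internalU D S x f)‖ₑ ^ 2 ∂(E.loebMeasure D S) ≤ ENNReal.ofReal (‖x‖ ^ 2) := by
  obtain ⟨X, a, d, w, -, -, hd, hw, -, -⟩ := exists_param D S D D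
  rw [lintegral_enorm_st_sq hE hS hDS hd hw (x := fun _ => x) tendsto_const_nhds]
  exact lintegral_norm_transform_sq_le hE hS hDS hd hw (Eventually.of_forall fun _ => le_rfl)

theorem memLp_st_internalU (x : H) :
    MemLp (fun f => E.st (E.internalU D S x f)) 2 (E.loebMeasure D S) := by
  refine ⟨aestronglyMeasurable_st_internalU hE hS hDS x, ?_⟩
  have h := (lintegral_enorm_st_sq_le hE hS hDS x).trans_lt ENNReal.ofReal_lt_top
  rw [← eLpNorm_two_sq] at h
  exact (ENNReal.pow_lt_top_iff.1 h).resolve_right two_ne_zero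

/-- The transform `U_L = st ∘ Ũ` as a linear map into `L₂(μ_L)`. -/
noncomputable def loebTransform : H →ₗ[𝕜] Lp 𝕜 2 (E.loebMeasure D S) where
  toFun x := (memLp_st_internalU hE hS hDS x).toLp
  map_add' x y := by
    obtain ⟨X, a, d, w, -, -, hd, hw, -, -⟩ := exists_param D S D D
    rw [← MemLp.toLp_add]
    refine MemLp.toLp_congr _ _ ?_
    filter_upwards [ae_tendsto_transform_const hE hS hDS hd hw x,
      ae_tendsto_transform_const hE hS hDS hd hw y,
      ae_tendsto_transform_const hE hS hDS hd hw (x + y)] with f h1 h2 h3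
    refine tendsto_nhds_unique h3 ((h1.add h2).congr fun z => ?_)
    rw [transform_add]
  map_smul' b x := by
    obtain ⟨X, a, d, w, -, -, hd, hw, -, -⟩ := exists_param D S D D
    rw [RingHom.id_apply, ← MemLp.toLp_const_smul]
    refine MemLp.toLp_congr _ _ ?_
    filter_upwards [ae_tendsto_transform_const hE hS hDS hd hw x,
      ae_tendsto_transform_const hE hS hDS hd hw (b • x)] with f h1 h2
    refine tendsto_nhds_unique h2 ((h1.const_mul b).congr fun z => ?_)
    rw [transform_smul]

theorem coeFn_loebTransform (x : H) : (loebTransform hE hS hDS x : E.LoebSpace D S → 𝕜)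
    =ᵐ[E.loebMeasure D S] fun f => E.st (E.internalU D S x f) :=
  MemLp.coeFn_toLp (memLp_st_internalU hE hS hDS x)

theorem ofReal_norm_loebTransform_sq (x : H) : ENNReal.ofReal (‖loebTransform hE hS hDS x‖ ^ 2) =
    ∫⁻ f, ‖E.st (E.internalU D S x f)‖ₑ ^ 2 ∂(E.loebMeasure D S) := by
  have hx := memLp_st_internalU hE hS hDS x
  change ENNReal.ofReal (‖hx.toLp‖ ^ 2) = _
  rw [← eLpNorm_two_sq, Lp.norm_toLp, ENNReal.ofReal_pow ENNReal.toReal_nonneg,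
    ENNReal.ofReal_toReal hx.2.ne]

theorem norm_loebTransform_le (x : H) : ‖loebTransform hE hS hDS x‖ ≤ ‖x‖ := by
  have h := lintegral_enorm_st_sq_le hE hS hDS x
  rw [← ofReal_norm_loebTransform_sq hE hS hDS, ENNReal.ofReal_le_ofReal_iff (by positivity)] at h
  exact (sq_le_sq₀ (norm_nonneg _) (norm_nonneg _)).1 h

/-- No mass escapes to infinity for a vector with a bounded lift. -/
theorem HasBoundedLift.norm_loebTransform {x : H} (hx : HasBoundedLift D S x) :
    ‖loebTransform hE hS hDS x‖ = ‖x‖ := by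
  obtain ⟨y, hyx, C, hC⟩ := hx
  obtain ⟨X, a, d, w, y, -, hd, hw, rfl, -⟩ := exists_param D S y y
  rw [← hd, ← hw, holds₃_map] at hC
  rw [isSt_map] at hyx
  have h := lintegral_loebFun_of_bounded hE (hDS.holds_meas_univ hS) hd hw
    (G := fun q f => ‖(d q).transform (w q) (y q) f‖ ^ 2) (C := C ^ 2) (B := ‖x‖ ^ 2)
    (Eventually.of_forall fun q f _ => by positivity)
    (by
      filter_upwards [hC] with q hq f hf
      have := hq.2 f hf
      gcongr)
    (by
      refine (tendsto_congr' ?_).1 (hyx.norm.pow 2)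
      filter_upwards [hC, hDS.eventually_weight_pos hd hw] with q hq1 hq2
      exact (sum_norm_transform_sq _ _ hq1.1 hq2).symm)
  rw [← lintegral_enorm_st_sq hE hS hDS hd hw hyx, ← ofReal_norm_loebTransform_sq hE hS hDS,
    ENNReal.ofReal_eq_ofReal_iff (by positivity) (by positivity)] at h
  exact (sq_eq_sq₀ (norm_nonneg _) (norm_nonneg _)).1 h

/-- The transform is isometric on the dense span of the standard parts of the `e_j`, by the bounded
lifts, and contractive, hence isometric everywhere. -/
theorem norm_loebTransform (x : H) : ‖loebTransform hE hS hDS x‖ = ‖x‖ := by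
  have hcont : Continuous (loebTransform hE hS hDS) :=
    AddMonoidHomClass.continuous_of_bound (loebTransform hE hS hDS) 1 fun x => by
      rw [one_mul]
      exact norm_loebTransform_le hE hS hDS x
  refine hS.dense_span.induction (P := fun x => ‖loebTransform hE hS hDS x‖ = ‖x‖)
    (fun x hx => HasBoundedLift.norm_loebTransform hE hS hDS ?_)
    (isClosed_eq hcont.norm continuous_norm) x
  refine Submodule.span_induction ?_ HasBoundedLift.zero
    (fun _ _ _ _ h h' => h.add h') (fun b _ _ h => h.smul b) hx
  rintro y ⟨j, hj, hy⟩
  exact hasBoundedLift_of_isSt_e hS hDS hj hy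

/-- The pointwise identity `Ũ(Ã x) = λ · Ũ x` on `Ω̃` passes to standard parts almost everywhere. -/
theorem loebTransform_mem_graph {p : H × H} (hp : p ∈ E.stGraph D) :
    (loebTransform hE hS hDS p.1, loebTransform hE hS hDS p.2) ∈
      (E.loebOperator D S).graph := by
  obtain ⟨x, y, hxy, hx, hy⟩ := hp
  obtain ⟨X, a, d, w, x, y, hd, hw, rfl, rfl⟩ := exists_param D S x y
  rw [← hd, holds₃_map] at hxy
  rw [isSt_map] at hx hy
  refine mem_graph_mulOperator_of_ae_eq ?_
  filter_upwards [coeFn_loebTransform hE hS hDS p.1, coeFn_loebTransform hE hS hDS p.2,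
    ae_tendsto_transform hE hS hDS hd hw hx, ae_tendsto_transform hE hS hDS hd hw hy,
    ae_loebMultiplier_ne hE hS hDS] with f h1 h2 h3 h4 h5
  rw [h1, h2]
  have hlim := tendsto_loebFun (a := a) (fun q f => (d q).eigenvalue f) f
  rw [← loebMultiplier_eq hd] at hlim
  have hlim' := (EReal.tendsto_toReal h5.2 h5.1).comp hlim
  refine tendsto_nhds_unique h4 (((((RCLike.continuous_ofReal (K := 𝕜)).tendsto _).comp
    hlim').mul h3).congr' ?_)
  filter_upwards [f.eventually_mem hd, eventually_ult_fst (b := f.val) hxy] with z hz1 hz2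
  exact (hz2.transform_eq (w z.1) hz1).symm

end U

end NonstandardExtension

theorem mainTheorem2
    {𝕜 : Type} {H : Type u} [RCLike 𝕜] [NormedAddCommGroup H] [InnerProductSpace 𝕜 H]
    [CompleteSpace H] [TopologicalSpace.SeparableSpace H] (hinf : ¬ FiniteDimensional 𝕜 H)
    -- a countably saturated nonstandard extension
    (E : NonstandardExtension.{u, v}) (hE : E.CountablySaturatedAt H)
    -- a densely defined symmetric operator
    (A : H →ₗ.[𝕜] H) (hdense : Dense (A.domain : Set H))
    (hsymm : ∀ x y : A.domain, ⟪A x, (y : H)⟫_𝕜 = ⟪(x : H), A y⟫_𝕜)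
    -- a sampling and a compatible standard-biased scale
    (D : E.star (FinModel 𝕜 H)) (hD : E.IsSampling A D)
    (S : E.star (FinScale H)) (hS : E.IsStandardBiased 𝕜 S) (hDS : E.IsCompatible D S) :
    -- the Loeb measure is a complete probability measure that extends `st ∘ μ̃`
    IsProbabilityMeasure (E.loebMeasure D S) ∧
    (E.loebMeasure D S).IsComplete ∧
    (∀ V : E.star (Set H), MeasurableSet (E.internalSet D S V) ∧
      E.loebMeasure D S (E.internalSet D S V) =
        (E.stE (E.internalMeasure D S V)).toENNReal) ∧
    -- `m_L` is measurable and almost everywhere real-valued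
    Measurable (E.loebMultiplier D S) ∧
    (∀ᵐ f ∂(E.loebMeasure D S), E.loebMultiplier D S f ≠ ⊥ ∧ E.loebMultiplier D S f ≠ ⊤) ∧
    -- `T_L` is densely defined and self-adjoint
    Dense ((E.loebOperator D S).domain : Set (Lp 𝕜 2 (E.loebMeasure D S))) ∧
    IsSelfAdjoint (E.loebOperator D S) ∧
    -- `U_L = st ∘ Ũ` is a well-defined linear isometry
    (∀ x : H, ∀ᵐ f ∂(E.loebMeasure D S), E.Nearstandard (E.internalU D S x f)) ∧
    ∃ U : H →ₗᵢ[𝕜] Lp 𝕜 2 (E.loebMeasure D S),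
      (∀ x : H, (U x : E.LoebSpace D S → 𝕜) =ᵐ[E.loebMeasure D S]
        fun f => E.st (E.internalU D S x f)) ∧
      -- `U_L x ∈ dom T_L` and `U_L y = T_L (U_L x)` for `(x, y) ∈ st(G(Ã))`
      (∀ p ∈ E.stGraph D, (U p.1, U p.2) ∈ (E.loebOperator D S).graph) ∧
      -- `U_L ∘ A ≤ T_L ∘ U_L`
      (∀ x : A.domain, (U (x : H), U (A x)) ∈ (E.loebOperator D S).graph) := by
  have h1 := hDS.holds_meas_univ hS
  have hU := (NonstandardExtension.exists_internalSet_univ h1).imp fun _ h => h.1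
  have hm := NonstandardExtension.measurable_loebMultiplier (D := D) (S := S)
  refine ⟨NonstandardExtension.isProbabilityMeasure_loebMeasure hE h1,
    NonstandardExtension.isComplete_loebMeasure,
    fun V => ⟨NonstandardExtension.measurableSet_internalSet V,
      NonstandardExtension.loebMeasure_internalSet hE hU V⟩,
    hm, NonstandardExtension.ae_loebMultiplier_ne hE hS hDS,
    dense_domain_mulOperator hm.ereal_toReal, isSelfAdjoint_mulOperator hm.ereal_toReal,
    NonstandardExtension.ae_nearstandard_internalU hE hS hDS,
    ⟨NonstandardExtension.loebTransform hE hS hDS,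
      NonstandardExtension.norm_loebTransform hE hS hDS⟩,
    NonstandardExtension.coeFn_loebTransform hE hS hDS,
    fun p hp => NonstandardExtension.loebTransform_mem_graph hE hS hDS hp,
    fun x => NonstandardExtension.loebTransform_mem_graph hE hS hDS (hD x)⟩
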